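/- **Model.** Fix $\lambda>0$, $d>0$, $\alpha>2$, $\theta>0$, $p\in(0,1]$. Transmitters $T_m$, $m\in\mathbb N$, are the points of a homogeneous Poisson point process on $\mathbb R^2$ with density $\lambda$; the receiver $R_m$ of $T_m$ is at distance $d$ from $T_m$ in a random direction (the directions are i.i.d. with an arbitrary law). The fading coefficients $h_{ms}$ between $T_s$ and $R_m$ are i.i.d. with Rayleigh distributed modulus. In every slot $t\in\mathbb N$ one unit of energy arrives at $T_m$ with probability $p$ and none with probability $1-p$. Batteries have infinite capacity and $E_m(t)$ denotes the energy of $T_m$ at time $t$; the initial energies $E_m(0)\in\mathbb N$ are i.i.d. with an arbitrary law. Under slotted ALOHA with access probability $q\in[0,1]$, in every slot in which $E_m(t)\ge 1$ the transmitter $T_m$ transmits with probability $q$, using one unit of energy. Locations, directions, fading, initial energies, arrivals and access decisions are all independent. With $\mathbf 1_{T_s}(t)$ the indicator that $T_s$ transmits in slot $t$, put $$\mathsf{SIR}_m(t)=\frac{d^{-\alpha}|h_{mm}|^2}{\sum_{s\ne m}\mathbf 1_{T_s}(t)\,\|T_s-R_m\|^{-\alpha}|h_{ms}|^2}.$$ Let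 $P_{suc}(t)$ be the probability that $\mathsf{SIR}(t)>\theta$ for the typical transmitter, that is, the expected number of transmitters $T_m$ in a window $W\subset\mathbb R^2$ with $\mathsf{SIR}_m(t)>\theta$, divided by $\lambda|W|$, where $W$ is any Borel set of positive finite area $|W|$. With $R=\log_2(1+\theta)$, the transmission capacity $C=C(q)$ is the limit as $t\to\infty$ of $\lambda\,P(E_m(t)\ge1)\,q\,P_{suc}(t)\,R$ (the probability $P(E_m(t)\ge1)$ does not depend on $m$). Let $$\lambda_{max}=\frac{1}{d^2\theta^{2/\alpha}\kappa(\alpha)},\qquad \kappa(\alpha)=\frac{2\pi^2}{\alpha\sin(2\pi/\alpha)}.$$ **Theorem 1.** The limit $C(q)$ exists for every $q\in[0,1]$. For every $q\in(0,1]$, $\lim_{t\to\infty}P(E_m(t)\ge 1)=r$ for all $m$, with $r=\min\{p/q,1\}$, and $$C(q)=\lambda r q\,\exp\!\left(-\frac{\lambda r q}{\lambda_{max}}\right)R .$$ If $p>\lambda_{max}/\lambda$, then $q^\star=\lambda_{max}/\lambda$ is the unique maximizer of $C$ over $q\in[0,1]$. Otherwise every $q\in[p,1]$ maximizes $C$ over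 $[0,1]$. -/

import Mathlib

open MeasureTheory ProbabilityTheory Filter Topology
open scoped ENNReal

namespace EnergyHarvesting

/-- The Euclidean plane. -/
abbrev Plane : Type := EuclideanSpace ℝ (Fin 2)

/-- The random elements of an energy harvesting ALOHA network, over a sample space `Ω`.
Transmitters are enumerated by `ℕ`, time slots by `ℕ`. -/
structure Network (Ω : Type*) where
  /-- location of transmitter `m` -/
  loc : ℕ → Ω → Plane
  /-- direction (a unit vector) from transmitter `m` to its receiver -/
  dir : ℕ → Ω → Plane
  /-- `fade m s`: fading coefficient from transmitter `s` to the receiver of transmitter `m` -/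
  fade : ℕ → ℕ → Ω → ℂ
  /-- energy in the battery of transmitter `m` at time `0` -/
  init : ℕ → Ω → ℕ
  /-- `arr m t`: does a unit of energy arrive at transmitter `m` in slot `t`? -/
  arr : ℕ → ℕ → Ω → Bool
  /-- `acc m t`: does transmitter `m`, if it has energy, access the channel in slot `t`? -/
  acc : ℕ → ℕ → Ω → Bool

/-- Number of points of the sequence `T` that lie in `B`. -/
noncomputable def pointCount {Ω : Type*} (T : ℕ → Ω → Plane) (B : Set Plane) (ω : Ω) : ℕ∞ :=
  {m | T m ω ∈ B}.encard

/-- `T` enumerates the points of a homogeneous Poisson point process of intensity `dens` on the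
plane: counts in sets of finite area are Poisson, counts in disjoint sets are independent. -/
structure IsPoissonProcess {Ω : Type*} [MeasurableSpace Ω] (μ : Measure Ω) (dens : ℝ)
    (T : ℕ → Ω → Plane) : Prop where
  measurable : ∀ m, Measurable (T m)
  poisson : ∀ B : Set Plane, MeasurableSet B → volume B ≠ ∞ → ∀ n : ℕ,
    μ {ω | pointCount T B ω = n} = poissonMeasure (dens * volume.real B).toNNReal {n}
  indep : ∀ (k : ℕ) (B : Fin k → Set Plane), (∀ i, MeasurableSet (B i)) →
    (∀ i, volume (B i) ≠ ∞) → Pairwise (fun i j => Disjoint (B i) (B j)) →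
    iIndepFun (fun i => pointCount T (B i)) μ

/-- The Rayleigh distribution with scale `σ`. -/
noncomputable def rayleighMeasure (σ : ℝ) : Measure ℝ :=
  volume.withDensity fun x =>
    ENNReal.ofReal (if 0 ≤ x then x / σ ^ 2 * Real.exp (-x ^ 2 / (2 * σ ^ 2)) else 0)

/-- Labels of the independent sources of randomness of a network. -/
inductive Source : Type
  | loc : Source
  | dir : ℕ → Source
  | fade : ℕ → ℕ → Source
  | init : ℕ → Source
  | arr : ℕ → ℕ → Source
  | acc : ℕ → ℕ → Source

namespace Network

variable {Ω : Type*}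

/-- The σ-algebra generated by each source; the whole point process is one single source. -/
@[reducible] noncomputable def sourceAlgebra (N : Network Ω) : Source → MeasurableSpace Ω
  | .loc => ⨆ m, MeasurableSpace.comap (N.loc m) inferInstance
  | .dir m => MeasurableSpace.comap (N.dir m) inferInstance
  | .fade m s => MeasurableSpace.comap (N.fade m s) inferInstance
  | .init m => MeasurableSpace.comap (N.init m) inferInstance
  | .arr m t => MeasurableSpace.comap (N.arr m t) inferInstance
  | .acc m t => MeasurableSpace.comap (N.acc m t) inferInstance

/-- The probabilistic model: transmitters at the points of a Poisson process of density `dens`,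
i.i.d. receiver directions, i.i.d. Rayleigh fading, i.i.d. initial energies, Bernoulli(`p`) energy
arrivals, access probability `q`, and everything mutually independent. -/
structure IsAloha [MeasurableSpace Ω] (N : Network Ω) (μ : Measure Ω) (dens p q : ℝ) : Prop where
  poisson : IsPoissonProcess μ dens N.loc
  measurable_dir : ∀ m, Measurable (N.dir m)
  norm_dir : ∀ m ω, ‖N.dir m ω‖ = 1
  ident_dir : ∀ m, IdentDistrib (N.dir m) (N.dir 0) μ μ
  measurable_fade : ∀ m s, Measurable (N.fade m s)
  rayleigh : ∃ σ : ℝ, 0 < σ ∧ ∀ m s, HasLaw (fun ω => ‖N.fade m s ω‖) (rayleighMeasure σ) μ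
  measurable_init : ∀ m, Measurable (N.init m)
  ident_init : ∀ m, IdentDistrib (N.init m) (N.init 0) μ μ
  measurable_arr : ∀ m t, Measurable (N.arr m t)
  prob_arr : ∀ m t, μ {ω | N.arr m t ω = true} = ENNReal.ofReal p
  measurable_acc : ∀ m t, Measurable (N.acc m t)
  prob_acc : ∀ m t, μ {ω | N.acc m t ω = true} = ENNReal.ofReal q
  indep : iIndep N.sourceAlgebra μ

/-- Energy `E_m(t)` in the (infinite) battery of transmitter `m` at time `t`: a transmission uses
one unit, an arrival adds one unit. -/
def battery (N : Network Ω) (m : ℕ) : ℕ → Ω → ℕ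
  | 0, ω => N.init m ω
  | t + 1, ω => N.battery m t ω + (N.arr m t ω).toNat
      - (if 1 ≤ N.battery m t ω then (N.acc m t ω).toNat else 0)

/-- Transmitter `m` transmits in slot `t`. -/
def Active (N : Network Ω) (m t : ℕ) (ω : Ω) : Prop :=
  1 ≤ N.battery m t ω ∧ N.acc m t ω = true

/-- Location of the receiver of transmitter `m`, at distance `d` from it. -/
noncomputable def receiver (N : Network Ω) (d : ℝ) (m : ℕ) (ω : Ω) : Plane :=
  N.loc m ω + d • N.dir m ω

/-- Power received by the receiver of transmitter `m` from transmitter `s` (if it transmits). -/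
noncomputable def rxPower (N : Network Ω) (d α : ℝ) (m s : ℕ) (ω : Ω) : ℝ≥0∞ :=
  ENNReal.ofReal (dist (N.loc s ω) (N.receiver d m ω) ^ (-α) * ‖N.fade m s ω‖ ^ 2)

/-- Total power received by the receiver of transmitter `m` in slot `t` from the other
transmitters. -/
noncomputable def interference (N : Network Ω) (d α : ℝ) (m t : ℕ) (ω : Ω) : ℝ≥0∞ :=
  ∑' s, Set.indicator {s | s ≠ m ∧ N.Active s t ω} (fun s => N.rxPower d α m s ω) s

/-- Signal to interference ratio `SIR_m(t)`; it is infinite in the absence of interference. -/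
noncomputable def sir (N : Network Ω) (d α : ℝ) (m t : ℕ) (ω : Ω) : ℝ≥0∞ :=
  ENNReal.ofReal (d ^ (-α) * ‖N.fade m m ω‖ ^ 2) / N.interference d α m t ω

variable [MeasurableSpace Ω]

/-- Probability `P(E_m(t) ≥ 1)` that transmitter `m` has energy at time `t`. -/
noncomputable def energyProb (N : Network Ω) (μ : Measure Ω) (m t : ℕ) : ℝ :=
  μ.real {ω | 1 ≤ N.battery m t ω}

/-- Probability that `SIR(t) > θ` for the typical transmitter (the Palm probability): the expected
number of transmitters in the window `W` with `SIR(t) > θ`, over the expected number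
of transmitters in `W`. -/
noncomputable def successProb (N : Network Ω) (μ : Measure Ω) (dens d α θ : ℝ) (W : Set Plane)
    (t : ℕ) : ℝ :=
  (∑' m, μ {ω | N.loc m ω ∈ W ∧ ENNReal.ofReal θ < N.sir d α m t ω}).toReal
    / (dens * volume.real W)

/-- Transmission capacity at time `t`, in bits: density `dens * r * q` of active transmitters,
times success probability, times rate. All transmitters have the same `r = P(E(t) ≥ 1)`; it is
read off at transmitter `0`. -/
noncomputable def capacityAt (N : Network Ω) (μ : Measure Ω) (dens d α θ q : ℝ) (W : Set Plane)
    (t : ℕ) : ℝ :=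
  dens * N.energyProb μ 0 t * q * N.successProb μ dens d α θ W t * Real.logb 2 (1 + θ)

end Network

/-- The constant `κ(α) = 2π² / (α sin(2π/α))`. -/
noncomputable def kappa (α : ℝ) : ℝ :=
  2 * Real.pi ^ 2 / (α * Real.sin (2 * Real.pi / α))

/-- The density `λ_max = 1 / (d² θ^(2/α) κ(α))`. -/
noncomputable def lambdaMax (d α θ : ℝ) : ℝ :=
  1 / (d ^ 2 * θ ^ (2 / α) * kappa α)

/-- The set of optimal transmission probabilities for a capacity function `C`. -/
def optimalProbs (C : ℝ → ℝ) : Set ℝ :=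
  {q | q ∈ Set.Icc (0 : ℝ) 1 ∧ ∀ q' ∈ Set.Icc (0 : ℝ) 1, C q' ≤ C q}

end EnergyHarvesting

open EnergyHarvesting

namespace EnergyHarvesting

/-! ### The battery as a Markov chain -/

/-! Two facts combine. At every time `t` the success probability is an explicit function of the
activity probability `a = P(E(t) ≥ 1) q`, and `a` tends to `min p q`.

Success probability. The squared modulus of a Rayleigh variable is exponential, so given the
interference `I` success has probability `exp (-s I)` for a constant `s` (`IsAloha.measure_sir`). At
a fixed time distinct transmitters are active independently, each with probability `a`,
independently of locations and fading. Given locations and directions, the Laplace transform of `I`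
therefore factorizes, and an interferer at distance `r` contributes `1 - a y / (1 + y)` with `y = θ
(d / r) ^ α` (`IsAloha.lintegral_prod_expNeg`). Summing such a product over the transmitters in the
window is a case of Mecke's formula, proved here from the Poisson counts alone
(`IsPoissonProcess.tsum_lintegral_translation`): the remaining points, seen from one of them, are
again Poisson. The result is the exponential of minus the density times the integral of the loss,
which Euler's reflection formula evaluates (`lintegral_interferenceLoss`). It does not depend on the
displacement of the receiver, so the law of the directions is irrelevant.

Battery. The level is a birth-death chain, increasing stochastically in its starting point. From an
empty battery the probability of having energy increases in time, hence converges. If `p ≤ q` the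
mean level is `O(√t)`, so arrivals and transmissions balance on average and the limit is `p / q`. If
`q < p` the level escapes to infinity and the limit is `1`. Exponential functions `z ^ n` yield
contraction bounds that carry these limits to every starting level (`tendsto_batteryOp_pow_ind`).

Optimization. The capacity depends on `q` only through `x = dens * min p q`, and `x exp (-x / l)`
increases up to its unique maximum at `x = l`, here with `l = lambdaMax d α θ`. -/

/-- Backward transition operator of the battery level. -/
noncomputable def batteryOp (p q : ℝ) : (ℕ → ℝ) →ₗ[ℝ] (ℕ → ℝ) where
  -- An empty battery cannot transmit even when energy arrives in the same slot, hence `max n 1`;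
  -- the truncated `n - 1` covers the empty battery without arrival.
  toFun f n := p * (q * f (max n 1) + (1 - q) * f (n + 1))
    + (1 - p) * (q * f (n - 1) + (1 - q) * f n)
  map_add' f g := by ext n; simp only [Pi.add_apply]; ring
  map_smul' c f := by ext n; simp only [Pi.smul_apply, smul_eq_mul, RingHom.id_apply]; ring

/-- Indicator that the battery is not empty. -/
def nonemptyInd (n : ℕ) : ℝ := if 1 ≤ n then 1 else 0

theorem batteryOp_apply (p q : ℝ) (f : ℕ → ℝ) (n : ℕ) :
    batteryOp p q f n = p * (q * f (max n 1) + (1 - q) * f (n + 1))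
      + (1 - p) * (q * f (n - 1) + (1 - q) * f n) := rfl

section

variable {p q : ℝ}

theorem batteryOp_one : batteryOp p q 1 = 1 := by
  ext n; simp only [batteryOp_apply, Pi.one_apply]; ring

theorem batteryOp_pow_one (t : ℕ) : (batteryOp p q ^ t) 1 = 1 := by
  induction t with
  | zero => simp
  | succ t ih => rw [pow_succ, Module.End.mul_apply, batteryOp_one, ih]

variable (hp : 0 ≤ p) (hp1 : p ≤ 1) (hq : 0 ≤ q) (hq1 : q ≤ 1)
include hp hp1 hq hq1

theorem batteryOp_le {f g : ℕ → ℝ} (h : f ≤ g) : batteryOp p q f ≤ batteryOp p q g := by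
  intro n
  simp only [batteryOp_apply]
  have := sub_nonneg.2 hp1
  have := sub_nonneg.2 hq1
  gcongr <;> exact h _

theorem batteryOp_pow_le {f g : ℕ → ℝ} (h : f ≤ g) (t : ℕ) :
    (batteryOp p q ^ t) f ≤ (batteryOp p q ^ t) g := by
  induction t with
  | zero => simpa using h
  | succ t ih =>
    rw [pow_succ', Module.End.mul_apply, Module.End.mul_apply]
    exact batteryOp_le hp hp1 hq hq1 ih

/-- Each of the four possible updates is nondecreasing in the level: the chain is stochastically
monotone. -/
theorem batteryOp_monotone {f : ℕ → ℝ} (h : Monotone f) : Monotone (batteryOp p q f) := by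
  intro m n hmn
  simp only [batteryOp_apply]
  have := sub_nonneg.2 hp1
  have := sub_nonneg.2 hq1
  gcongr <;> apply h <;> omega

theorem batteryOp_pow_monotone {f : ℕ → ℝ} (h : Monotone f) (t : ℕ) :
    Monotone ((batteryOp p q ^ t) f) := by
  induction t with
  | zero => simpa using h
  | succ t ih =>
    rw [pow_succ', Module.End.mul_apply]
    exact batteryOp_monotone hp hp1 hq hq1 ih

omit hp hp1 hq hq1 in
theorem nonemptyInd_monotone : Monotone nonemptyInd := by
  intro m n hmn
  unfold nonemptyInd
  split_ifs <;> first | omega | norm_num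

omit hp hp1 hq hq1 in
theorem nonemptyInd_nonneg : 0 ≤ nonemptyInd := by
  intro n; unfold nonemptyInd; split_ifs <;> simp

omit hp hp1 hq hq1 in
theorem nonemptyInd_le_one : nonemptyInd ≤ 1 := by
  intro n; unfold nonemptyInd; split_ifs <;> simp

theorem batteryOp_pow_ind_le_one (t n : ℕ) : (batteryOp p q ^ t) nonemptyInd n ≤ 1 := by
  have := batteryOp_pow_le hp hp1 hq hq1 nonemptyInd_le_one t n
  rwa [batteryOp_pow_one] at this

/-- The first step from an empty battery can only go up, and the function it is then fed to is
increasing in the level. -/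
theorem batteryOp_pow_ind_zero_monotone :
    Monotone fun t => (batteryOp p q ^ t) nonemptyInd 0 := by
  refine monotone_nat_of_le_succ fun t => ?_
  have h := batteryOp_pow_monotone hp hp1 hq hq1 nonemptyInd_monotone t
  rw [pow_succ', Module.End.mul_apply, batteryOp_apply]
  set f := (batteryOp p q ^ t) nonemptyInd
  have h1 : f 0 ≤ f 1 := h (by omega)
  simp only [zero_le, sup_of_le_right, zero_add, Nat.zero_sub]
  nlinarith

-- Drift of the chain: a mean gain `p` in every slot and a mean loss `q` exactly when the battery is
-- not empty.
omit hp hp1 hq hq1 in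
theorem batteryOp_cast :
    batteryOp p q (fun n : ℕ => (n : ℝ)) = (fun n : ℕ => (n : ℝ)) + p • 1 - q • nonemptyInd := by
  ext n
  simp only [batteryOp_apply, Pi.sub_apply, Pi.add_apply, Pi.smul_apply, smul_eq_mul,
    Pi.one_apply, nonemptyInd]
  rcases n with _ | n
  · simp
  · simp; ring

-- Energy balance from an empty start: mean level equals mean arrivals minus mean transmissions. It
-- turns a bound on the level into a Cesàro mean of the probability of having energy.
omit hp hp1 hq hq1 in
theorem batteryOp_pow_cast_zero (t : ℕ) :
    (batteryOp p q ^ t) (fun n : ℕ => (n : ℝ)) 0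
      = t * p - q * ∑ s ∈ Finset.range t, (batteryOp p q ^ s) nonemptyInd 0 := by
  induction t with
  | zero => simp
  | succ t ih =>
    rw [pow_succ, Module.End.mul_apply, batteryOp_cast, map_sub, map_add, map_smul, map_smul,
      batteryOp_pow_one, Finset.sum_range_succ]
    simp only [Pi.sub_apply, Pi.add_apply, Pi.smul_apply, smul_eq_mul, Pi.one_apply, ih]
    push_cast
    ring

-- The cross term `2 n (p - q)` is nonpositive, so the second moment grows at most linearly in time.
omit hq1 in
theorem batteryOp_sq_le (hpq : p ≤ q) :
    batteryOp p q (fun n : ℕ => (n : ℝ) ^ 2) ≤ (fun n : ℕ => (n : ℝ) ^ 2) + (2 : ℝ) • 1 := by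
  intro n
  simp only [batteryOp_apply, Pi.add_apply, Pi.smul_apply, smul_eq_mul, Pi.one_apply]
  rcases n with _ | n
  · simp; nlinarith
  · simp
    have : (0 : ℝ) ≤ n := n.cast_nonneg
    nlinarith [mul_nonneg this (sub_nonneg.2 hpq), mul_nonneg hp hq]

theorem batteryOp_pow_sq_zero_le (hpq : p ≤ q) (t : ℕ) :
    (batteryOp p q ^ t) (fun n : ℕ => (n : ℝ) ^ 2) 0 ≤ 2 * t := by
  induction t with
  | zero => simp
  | succ t ih =>
    rw [pow_succ, Module.End.mul_apply]
    have := batteryOp_pow_le hp hp1 hq hq1 (batteryOp_sq_le hp hp1 hq hpq) t 0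
    rw [map_add, map_smul, batteryOp_pow_one] at this
    simp only [Pi.add_apply, Pi.smul_apply, smul_eq_mul, Pi.one_apply] at this
    push_cast
    linarith

theorem batteryOp_pow_cast_zero_nonneg (t : ℕ) :
    0 ≤ (batteryOp p q ^ t) (fun n : ℕ => (n : ℝ)) 0 := by
  have : (0 : ℕ → ℝ) ≤ fun n : ℕ => (n : ℝ) := fun n => n.cast_nonneg
  have := batteryOp_pow_le hp hp1 hq hq1 this t 0
  rwa [map_zero] at this

theorem batteryOp_pow_cast_zero_le (hpq : p ≤ q) (t : ℕ) :
    (batteryOp p q ^ t) (fun n : ℕ => (n : ℝ)) 0 ≤ 2 * √t := by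
  rcases Nat.eq_zero_or_pos t with rfl | ht
  · simp
  have hs : 0 < √(t : ℝ) := Real.sqrt_pos.2 (by exact_mod_cast ht)
  have hss : √(t : ℝ) * √t = t := Real.mul_self_sqrt t.cast_nonneg
  set s := √(t : ℝ) with hsdef
  -- AM-GM at scale `s = √t`, in place of Cauchy-Schwarz: it bounds the mean by the second moment
  -- using only linearity and positivity of the operator.
  have h : (fun n : ℕ => (n : ℝ)) ≤ (1 / (2 * s)) • (fun n : ℕ => (n : ℝ) ^ 2) + (s / 2) • 1 := by
    intro n
    simp only [Pi.add_apply, Pi.smul_apply, smul_eq_mul, Pi.one_apply]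
    have : 1 / (2 * s) * (n : ℝ) ^ 2 + s / 2 * 1 - n = (n - s) ^ 2 / (2 * s) := by
      field_simp; ring
    have h2 : 0 ≤ ((n : ℝ) - s) ^ 2 / (2 * s) := by positivity
    linarith
  have h1 := batteryOp_pow_le hp hp1 hq hq1 h t 0
  rw [map_add, map_smul, map_smul, batteryOp_pow_one] at h1
  simp only [Pi.add_apply, Pi.smul_apply, smul_eq_mul, Pi.one_apply] at h1
  have h2 := batteryOp_pow_sq_zero_le hp hp1 hq hq1 hpq t
  have h3 : 1 / (2 * s) * (batteryOp p q ^ t) (fun n : ℕ => (n : ℝ) ^ 2) 0 ≤ 1 / (2 * s) * (2 * t) := by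
    gcongr
  have h4 : 1 / (2 * s) * (2 * t) = s := by rw [← hss]; field_simp
  linarith

/-- Monotonicity in time gives a limit, which is also the Cesàro limit. The energy balance
identifies it, since the mean level is `o(t)`. -/
theorem tendsto_batteryOp_pow_ind_zero (hpq : p ≤ q) (hq0 : 0 < q) :
    Tendsto (fun t => (batteryOp p q ^ t) nonemptyInd 0) atTop (𝓝 (p / q)) := by
  have hm := batteryOp_pow_ind_zero_monotone hp hp1 hq hq1
  have hb : BddAbove (Set.range fun t => (batteryOp p q ^ t) nonemptyInd 0) :=
    ⟨1, by rintro _ ⟨t, rfl⟩; exact batteryOp_pow_ind_le_one hp hp1 hq hq1 t 0⟩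
  have hL := tendsto_atTop_ciSup hm hb
  set L := ⨆ t, (batteryOp p q ^ t) nonemptyInd 0
  have h0 : Tendsto (fun t : ℕ => (batteryOp p q ^ t) (fun n : ℕ => (n : ℝ)) 0 / t) atTop (𝓝 0) := by
    have hz : Tendsto (fun t : ℕ => 2 * (√(t : ℝ))⁻¹) atTop (𝓝 (2 * 0)) :=
      (tendsto_inv_atTop_zero.comp
        (Real.tendsto_sqrt_atTop.comp tendsto_natCast_atTop_atTop)).const_mul 2
    rw [mul_zero] at hz
    refine squeeze_zero (fun t => ?_) (fun t => ?_) hz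
    · exact div_nonneg (batteryOp_pow_cast_zero_nonneg hp hp1 hq hq1 t) t.cast_nonneg
    · calc _ ≤ 2 * √(t : ℝ) / t := by
            gcongr; exact batteryOp_pow_cast_zero_le hp hp1 hq hq1 hpq t
        _ = _ := by rw [mul_div_assoc, Real.sqrt_div_self]
  have h1 : Tendsto (fun t : ℕ => (p - (batteryOp p q ^ t) (fun n : ℕ => (n : ℝ)) 0 / t) / q) atTop
      (𝓝 (p / q)) := by
    simpa using (h0.const_sub p).div_const q
  have h2 := hL.cesaro
  have h3 : (fun t : ℕ => (p - (batteryOp p q ^ t) (fun n : ℕ => (n : ℝ)) 0 / t) / q)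
      =ᶠ[atTop] fun t : ℕ => (t : ℝ)⁻¹ * ∑ s ∈ Finset.range t,
        (batteryOp p q ^ s) nonemptyInd 0 := by
    filter_upwards [eventually_gt_atTop 0] with t ht
    have : (t : ℝ) ≠ 0 := by exact_mod_cast ht.ne'
    rw [batteryOp_pow_cast_zero]
    field_simp
    ring
  rwa [tendsto_nhds_unique (h2.congr' h3.symm) h1] at hL

/-- Two chains driven by the same arrivals and accesses keep their order. The bound involves only
the upper level, which evolves as a free random walk away from `0`, so `z ^ n` is multiplied by the
generating function of one increment. -/
theorem batteryOp_sub_le {f : ℕ → ℝ} {c z : ℝ} (hz : 0 < z)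
    (h : ∀ m n, m ≤ n → f n - f m ≤ c * z ^ n)
    {m n : ℕ} (hmn : m < n) :
    batteryOp p q f n - batteryOp p q f m
      ≤ c * (p * q + p * (1 - q) * z + (1 - p) * q / z + (1 - p) * (1 - q)) * z ^ n := by
  -- Since `m < n`, the upper level is positive and none of its updates is truncated.
  obtain ⟨n, rfl⟩ : ∃ k, n = k + 1 := ⟨n - 1, by omega⟩

  have e1 := h (max m 1) (max (n + 1) 1) (by omega)
  have e2 := h (m + 1) (n + 1 + 1) (by omega)
  have e3 := h (m - 1) (n + 1 - 1) (by omega)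
  have e4 := h m (n + 1) (by omega)
  simp only [batteryOp_apply]
  have hp' := sub_nonneg.2 hp1
  have hq' := sub_nonneg.2 hq1
  have i1 := mul_le_mul_of_nonneg_left e1 (mul_nonneg hp hq)
  have i2 := mul_le_mul_of_nonneg_left e2 (mul_nonneg hp hq')
  have i3 := mul_le_mul_of_nonneg_left e3 (mul_nonneg hp' hq)
  have i4 := mul_le_mul_of_nonneg_left e4 (mul_nonneg hp' hq')
  have hmax : max (n + 1) 1 = n + 1 := by omega
  have hsub : n + 1 - 1 = n := rfl
  rw [hmax] at i1 ⊢
  rw [hsub] at i3 ⊢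
  have : c * (p * q + p * (1 - q) * z + (1 - p) * q / z + (1 - p) * (1 - q)) * z ^ (n + 1)
      = p * q * (c * z ^ (n + 1)) + p * (1 - q) * (c * z ^ (n + 1 + 1))
        + (1 - p) * q * (c * z ^ n) + (1 - p) * (1 - q) * (c * z ^ (n + 1)) := by
    field_simp; ring
  rw [this]
  linarith

theorem batteryOp_pow_sub_le {z : ℝ} (hz : 0 < z) {f : ℕ → ℝ}
    (h : ∀ m n, m ≤ n → f n - f m ≤ z ^ n) (t : ℕ) {m n : ℕ} (hmn : m ≤ n) :
    (batteryOp p q ^ t) f n - (batteryOp p q ^ t) f m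
      ≤ (p * q + p * (1 - q) * z + (1 - p) * q / z + (1 - p) * (1 - q)) ^ t * z ^ n := by
  have hp' := sub_nonneg.2 hp1
  have hq' := sub_nonneg.2 hq1
  induction t generalizing m n with
  | zero => simpa using h m n hmn
  | succ t ih =>
    rw [pow_succ', Module.End.mul_apply]
    -- Chains that have met stay together, so equal levels contribute nothing.
    rcases hmn.eq_or_lt with rfl | hlt
    · rw [sub_self]; positivity
    · rw [pow_succ]
      exact batteryOp_sub_le hp hp1 hq hq1 hz
        (fun m n hmn => ih hmn) hlt

theorem tendsto_batteryOp_pow_ind_of_le (hpq : p ≤ q) (hq0 : 0 < q) (k : ℕ) :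
    Tendsto (fun t => (batteryOp p q ^ t) nonemptyInd k) atTop (𝓝 (p / q)) := by
  have h0 := tendsto_batteryOp_pow_ind_zero hp hp1 hq hq1 hpq hq0
  have hlow : ∀ t, (batteryOp p q ^ t) nonemptyInd 0 ≤ (batteryOp p q ^ t) nonemptyInd k :=
    fun t => batteryOp_pow_monotone hp hp1 hq hq1 nonemptyInd_monotone t (Nat.zero_le k)
  rcases hpq.eq_or_lt with rfl | hlt
  · rw [div_self hq0.ne'] at h0 ⊢
    exact tendsto_of_tendsto_of_tendsto_of_le_of_le h0 tendsto_const_nhds hlow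
      fun t => batteryOp_pow_ind_le_one hp hp1 hq hq1 t k
  · have hp' := sub_nonneg.2 hp1
    have hq' := sub_nonneg.2 hq1
    obtain ⟨z, hz, hρ⟩ : ∃ z : ℝ, 1 ≤ z ∧
        p * q + p * (1 - q) * z + (1 - p) * q / z + (1 - p) * (1 - q) < 1 := by
      -- The generating function equals `1` at `z = 1` with derivative `p - q < 0`, so it is below
      -- `1` slightly to the right; the bound `p (1 - q) ≤ 1` makes this `δ` small enough.
      refine ⟨1 + (q - p) / 2, by linarith, ?_⟩
      set δ := (q - p) / 2 with hδ
      have hδ0 : 0 < δ := by rw [hδ]; linarith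
      have hz0 : 0 < 1 + δ := by linarith
      have h1 : p * (1 - q) ≤ 1 := mul_le_one₀ hp1 hq' (by linarith)
      have h2 : p * (1 - q) * δ < q - p := by nlinarith
      have : p * q + p * (1 - q) * (1 + δ) + (1 - p) * q / (1 + δ) + (1 - p) * (1 - q) - 1
          = δ * (p * (1 - q) * δ - (q - p)) / (1 + δ) := by field_simp; ring
      have h3 : δ * (p * (1 - q) * δ - (q - p)) / (1 + δ) < 0 :=
        div_neg_of_neg_of_pos (mul_neg_of_pos_of_neg hδ0 (by linarith)) hz0
      linarith
    have hz0 : 0 < z := by linarith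
    set ρ := p * q + p * (1 - q) * z + (1 - p) * q / z + (1 - p) * (1 - q) with hρdef
    have hρ0 : 0 ≤ ρ := by positivity
    have hup : ∀ t, (batteryOp p q ^ t) nonemptyInd k
        ≤ (batteryOp p q ^ t) nonemptyInd 0 + ρ ^ t * z ^ k := by
      intro t
      have := batteryOp_pow_sub_le hp hp1 hq hq1 hz0 (f := nonemptyInd) (fun m n _ => by
        have h1 := nonemptyInd_le_one n
        have h2 := nonemptyInd_nonneg m
        have h3 := one_le_pow₀ hz (n := n)
        simp only [Pi.one_apply, Pi.zero_apply] at h1 h2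
        linarith) t (Nat.zero_le k)
      linarith
    refine tendsto_of_tendsto_of_tendsto_of_le_of_le h0 ?_ hlow hup
    simpa using h0.add ((tendsto_pow_atTop_nhds_zero_of_lt_one hρ0 hρ).mul_const (z ^ k))

/-- With upward drift, `z ^ n` for some `z < 1` is a Lyapunov function: its mean decays
geometrically, and it dominates the indicator of the empty battery. -/
theorem tendsto_batteryOp_pow_ind_of_lt (hpq : q < p) (k : ℕ) :
    Tendsto (fun t => (batteryOp p q ^ t) nonemptyInd k) atTop (𝓝 1) := by
  have hp' := sub_nonneg.2 hp1
  have hq' := sub_nonneg.2 hq1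
  obtain ⟨z, hz0, hz, hρ⟩ : ∃ z : ℝ, 0 < z ∧ z ≤ 1 ∧
      p * q + p * (1 - q) * z + (1 - p) * q / z + (1 - p) * (1 - q) < 1 := by
    refine ⟨1 - (p - q) / 2, by linarith, by linarith, ?_⟩
    set δ := (p - q) / 2 with hδ
    have hδ0 : 0 < δ := by rw [hδ]; linarith
    have hz0 : 0 < 1 - δ := by rw [hδ]; linarith
    have h1 : p * (1 - q) ≤ 1 := mul_le_one₀ hp1 hq' (by linarith)
    have h2 : p * (1 - q) * δ < p - q := by nlinarith
    have : p * q + p * (1 - q) * (1 - δ) + (1 - p) * q / (1 - δ) + (1 - p) * (1 - q) - 1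
        = δ * (p * (1 - q) * δ - (p - q)) / (1 - δ) := by field_simp; ring
    have h3 : δ * (p * (1 - q) * δ - (p - q)) / (1 - δ) < 0 :=
      div_neg_of_neg_of_pos (mul_neg_of_pos_of_neg hδ0 (by linarith)) hz0
    linarith
  set ρ := p * q + p * (1 - q) * z + (1 - p) * q / z + (1 - p) * (1 - q) with hρdef
  have hρ0 : 0 ≤ ρ := by positivity
  have hV : batteryOp p q (fun n => z ^ n) ≤ ρ • fun n => z ^ n := by
    intro n
    simp only [batteryOp_apply, Pi.smul_apply, smul_eq_mul]
    -- At `n = 0` the reflected moves have values `z ≤ 1` and `1 ≤ 1 / z`, so the boundary only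
    -- helps; for positive levels there is equality.
    rcases n with _ | n
    · have : 1 ≤ 1 / z := by rw [le_div_iff₀ hz0]; linarith
      have h4 : (1 - p) * q * 1 ≤ (1 - p) * q * (1 / z) := by gcongr
      simp
      have h5 : p * q * z ≤ p * q * 1 := by gcongr
      rw [mul_one_div] at h4
      rw [hρdef]
      nlinarith
    · have hmax : max (n + 1) 1 = n + 1 := by omega
      have hsub : n + 1 - 1 = n := rfl
      rw [hmax, hsub, hρdef]
      apply le_of_eq
      field_simp
      ring
  have hVt : ∀ t, (batteryOp p q ^ t) (fun n => z ^ n) ≤ ρ ^ t • fun n => z ^ n := by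
    intro t
    induction t with
    | zero => simp
    | succ t ih =>
      rw [pow_succ, Module.End.mul_apply]
      refine (batteryOp_pow_le hp hp1 hq hq1 hV t).trans ?_
      rw [map_smul, pow_succ', mul_smul]
      intro n
      simp only [Pi.smul_apply, smul_eq_mul] at ih ⊢
      exact mul_le_mul_of_nonneg_left (ih n) hρ0
  have hlow : ∀ t, 1 - ρ ^ t ≤ (batteryOp p q ^ t) nonemptyInd k := by
    intro t
    have h1 : (1 : ℕ → ℝ) - nonemptyInd ≤ fun n => z ^ n := by
      intro n
      simp only [Pi.sub_apply, Pi.one_apply, nonemptyInd]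
      split_ifs with h
      · simpa using pow_nonneg hz0.le n
      · obtain rfl : n = 0 := by omega
        simp
    have h2 := (batteryOp_pow_le hp hp1 hq hq1 h1 t k).trans (hVt t k)
    rw [map_sub, batteryOp_pow_one] at h2
    simp only [Pi.sub_apply, Pi.one_apply, Pi.smul_apply, smul_eq_mul] at h2
    have h3 : ρ ^ t * z ^ k ≤ ρ ^ t * 1 := by
      gcongr; exact pow_le_one₀ hz0.le hz
    linarith
  refine tendsto_of_tendsto_of_tendsto_of_le_of_le ?_ tendsto_const_nhds hlow
    fun t => batteryOp_pow_ind_le_one hp hp1 hq hq1 t k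
  simpa using (tendsto_pow_atTop_nhds_zero_of_lt_one hρ0 hρ).const_sub 1

theorem tendsto_batteryOp_pow_ind (hq0 : 0 < q) (k : ℕ) :
    Tendsto (fun t => (batteryOp p q ^ t) nonemptyInd k) atTop (𝓝 (min (p / q) 1)) := by
  rcases le_or_gt p q with h | h
  · rw [min_eq_left (div_le_one_of_le₀ h hq)]
    exact tendsto_batteryOp_pow_ind_of_le hp hp1 hq hq1 h hq0 k
  · rw [min_eq_right ((one_le_div hq0).2 h.le)]
    exact tendsto_batteryOp_pow_ind_of_lt hp hp1 hq hq1 h k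

end

end EnergyHarvesting

namespace EnergyHarvesting

/-! ### Integration against independent σ-algebras -/

/-- The joint law is a product, so Tonelli applies. This is the form in which conditioning on a
family of sources is used throughout. -/
theorem lintegral_comp_of_indep {Ω β γ : Type*} {M₁ M₂ mΩ : MeasurableSpace Ω} {μ : Measure Ω}
    [IsProbabilityMeasure μ] [MeasurableSpace β] [MeasurableSpace γ]
    (h₁ : M₁ ≤ mΩ) (h₂ : M₂ ≤ mΩ) (h : Indep M₁ M₂ μ)
    {X : Ω → β} {Y : Ω → γ} (hX : Measurable[M₁] X) (hY : Measurable[M₂] Y)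
    {F : β → γ → ℝ≥0∞} (hF : Measurable (Function.uncurry F)) :
    ∫⁻ ω, F (X ω) (Y ω) ∂μ = ∫⁻ ω, ∫⁻ ω', F (X ω) (Y ω') ∂μ ∂μ := by
  have hX' : Measurable X := hX.mono h₁ le_rfl
  have hY' : Measurable Y := hY.mono h₂ le_rfl
  have hind : IndepFun X Y μ := by
    rw [IndepFun_iff_Indep]
    exact indep_of_indep_of_le_left (indep_of_indep_of_le_right h hY.comap_le) hX.comap_le
  have hmap := hind.map_prod_eq_prod_map_map hX'.aemeasurable hY'.aemeasurable
  have := Measure.isProbabilityMeasure_map (μ := μ) hY'.aemeasurable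
  calc ∫⁻ ω, F (X ω) (Y ω) ∂μ
      = ∫⁻ z, Function.uncurry F z ∂(μ.map fun ω => (X ω, Y ω)) := by
        rw [lintegral_map hF (hX'.prodMk hY')]; rfl
    _ = ∫⁻ x, ∫⁻ y, F x y ∂(μ.map Y) ∂(μ.map X) := by
        rw [hmap, lintegral_prod _ hF.aemeasurable]; rfl
    _ = ∫⁻ ω, ∫⁻ y, F (X ω) y ∂(μ.map Y) ∂μ := by
        rw [lintegral_map (f := fun x => ∫⁻ y, F x y ∂(μ.map Y))
          (Measurable.lintegral_prod_right' hF) hX']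
    _ = _ := by
        refine lintegral_congr fun ω => ?_
        rw [lintegral_map (f := fun y => F (X ω) y) (hF.comp measurable_prodMk_left) hY']

theorem lintegral_bool {Ω : Type*} [MeasurableSpace Ω] {μ : Measure Ω} [IsProbabilityMeasure μ]
    {A : Ω → Bool} (hA : Measurable A) {p : ℝ} (hp : 0 ≤ p)
    (h : μ {ω | A ω = true} = ENNReal.ofReal p) (g : Bool → ℝ≥0∞) :
    ∫⁻ ω, g (A ω) ∂μ = ENNReal.ofReal p * g true + ENNReal.ofReal (1 - p) * g false := by
  have hm : MeasurableSet {ω | A ω = true} := hA (measurableSet_singleton true)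
  have hc : μ {ω | A ω = false} = ENNReal.ofReal (1 - p) := by
    have : {ω | A ω = false} = {ω | A ω = true}ᶜ := by ext; simp
    rw [this, prob_compl_eq_one_sub hm, h, ENNReal.ofReal_sub _ hp, ENNReal.ofReal_one]
  rw [← lintegral_map (measurable_of_finite g) hA, lintegral_fintype]
  · simp only [Fintype.sum_bool]
    rw [Measure.map_apply hA (measurableSet_singleton _),
      Measure.map_apply hA (measurableSet_singleton _)]
    change g true * μ {ω | A ω = true} + g false * μ {ω | A ω = false} = _
    rw [h, hc, mul_comm, mul_comm (g false)]

/-! ### Sources of randomness and the law of the battery -/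

namespace Network

variable {Ω : Type*}

/-- The σ-algebra generated by a set of sources. -/
@[reducible] noncomputable def sigma (N : Network Ω) (S : Set Source) : MeasurableSpace Ω :=
  ⨆ i ∈ S, N.sourceAlgebra i

theorem sourceAlgebra_le_sigma (N : Network Ω) {S : Set Source} {i : Source} (hi : i ∈ S) :
    N.sourceAlgebra i ≤ N.sigma S :=
  le_iSup₂_of_le i hi le_rfl

theorem sigma_mono (N : Network Ω) {S T : Set Source} (h : S ⊆ T) : N.sigma S ≤ N.sigma T :=
  biSup_mono fun _ hi => h hi

section sigma

variable (N : Network Ω) {S : Set Source}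

theorem measurable_loc_sigma (hS : Source.loc ∈ S) (m : ℕ) : Measurable[N.sigma S] (N.loc m) :=
  Measurable.of_comap_le <|
    (le_iSup (fun m => MeasurableSpace.comap (N.loc m) inferInstance) m).trans
      (N.sourceAlgebra_le_sigma hS)

theorem measurable_dir_sigma {m : ℕ} (hS : Source.dir m ∈ S) : Measurable[N.sigma S] (N.dir m) :=
  Measurable.of_comap_le (N.sourceAlgebra_le_sigma hS)

theorem measurable_fade_sigma {m s : ℕ} (hS : Source.fade m s ∈ S) :
    Measurable[N.sigma S] (N.fade m s) :=
  Measurable.of_comap_le (N.sourceAlgebra_le_sigma hS)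

theorem measurable_init_sigma {m : ℕ} (hS : Source.init m ∈ S) :
    Measurable[N.sigma S] (N.init m) :=
  Measurable.of_comap_le (N.sourceAlgebra_le_sigma hS)

theorem measurable_arr_sigma {m t : ℕ} (hS : Source.arr m t ∈ S) :
    Measurable[N.sigma S] (N.arr m t) :=
  Measurable.of_comap_le (N.sourceAlgebra_le_sigma hS)

theorem measurable_acc_sigma {m t : ℕ} (hS : Source.acc m t ∈ S) :
    Measurable[N.sigma S] (N.acc m t) :=
  Measurable.of_comap_le (N.sourceAlgebra_le_sigma hS)

/-- One step of the battery. -/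
def batteryStep (n : ℕ) (x : Bool × Bool) : ℕ :=
  n + x.1.toNat - (if 1 ≤ n then x.2.toNat else 0)

theorem battery_succ (m t : ℕ) (ω : Ω) :
    N.battery m (t + 1) ω = batteryStep (N.battery m t ω) (N.arr m t ω, N.acc m t ω) := rfl

theorem measurable_batteryStep : Measurable (Function.uncurry batteryStep) :=
  measurable_of_countable _

/-- The sources that determine the battery of transmitter `m` at time `t`. -/
def batterySources (m t : ℕ) : Set Source :=
  {i | i = .init m ∨ ∃ s < t, i = .arr m s ∨ i = .acc m s}

theorem batterySources_mono (m : ℕ) {t t' : ℕ} (h : t ≤ t') :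
    batterySources m t ⊆ batterySources m t' := by
  rintro i (hi | ⟨s, hs, hi⟩)
  · exact .inl hi
  · exact .inr ⟨s, hs.trans_le h, hi⟩

theorem measurable_battery_sigma (m t : ℕ) :
    Measurable[N.sigma (batterySources m t)] (N.battery m t) := by
  induction t with
  | zero => exact N.measurable_init_sigma (.inl rfl)
  | succ t ih =>
    have h1 : Measurable[N.sigma (batterySources m (t + 1))] (N.battery m t) :=
      ih.mono (N.sigma_mono (batterySources_mono m t.le_succ)) le_rfl
    have h2 : Measurable[N.sigma (batterySources m (t + 1))] (N.arr m t) :=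
      N.measurable_arr_sigma (.inr ⟨t, t.lt_succ_self, .inl rfl⟩)
    have h3 : Measurable[N.sigma (batterySources m (t + 1))] (N.acc m t) :=
      N.measurable_acc_sigma (.inr ⟨t, t.lt_succ_self, .inr rfl⟩)
    exact measurable_batteryStep.comp (h1.prodMk (h2.prodMk h3))

end sigma

variable [mΩ : MeasurableSpace Ω] {N : Network Ω} {μ : Measure Ω} {dens p q : ℝ}

theorem IsAloha.sourceAlgebra_le (h : N.IsAloha μ dens p q) (i : Source) :
    N.sourceAlgebra i ≤ mΩ := by
  cases i with
  | loc => exact iSup_le fun m => (h.poisson.measurable m).comap_le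
  | dir m => exact (h.measurable_dir m).comap_le
  | fade m s => exact (h.measurable_fade m s).comap_le
  | init m => exact (h.measurable_init m).comap_le
  | arr m t => exact (h.measurable_arr m t).comap_le
  | acc m t => exact (h.measurable_acc m t).comap_le

theorem IsAloha.sigma_le (h : N.IsAloha μ dens p q) (S : Set Source) : N.sigma S ≤ mΩ :=
  iSup₂_le fun i _ => h.sourceAlgebra_le i

theorem IsAloha.indep_sigma (h : N.IsAloha μ dens p q) {S T : Set Source} (hST : Disjoint S T) :
    Indep (N.sigma S) (N.sigma T) μ :=
  indep_iSup_of_disjoint h.sourceAlgebra_le h.indep hST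

theorem IsAloha.measurable_battery (h : N.IsAloha μ dens p q) (m t : ℕ) :
    Measurable (N.battery m t) :=
  (N.measurable_battery_sigma m t).mono (h.sigma_le _) le_rfl

variable [IsProbabilityMeasure μ]

theorem IsAloha.lintegral_comp (h : N.IsAloha μ dens p q) {β γ : Type*} [MeasurableSpace β]
    [MeasurableSpace γ] {S T : Set Source} (hST : Disjoint S T)
    {X : Ω → β} {Y : Ω → γ} (hX : Measurable[N.sigma S] X) (hY : Measurable[N.sigma T] Y)
    {F : β → γ → ℝ≥0∞} (hF : Measurable (Function.uncurry F)) :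
    ∫⁻ ω, F (X ω) (Y ω) ∂μ = ∫⁻ ω, ∫⁻ ω', F (X ω) (Y ω') ∂μ ∂μ :=
  lintegral_comp_of_indep (h.sigma_le S) (h.sigma_le T) (h.indep_sigma hST) hX hY hF

theorem IsAloha.lintegral_arr_acc (h : N.IsAloha μ dens p q) (hp : 0 ≤ p) (hq : 0 ≤ q)
    (m t : ℕ) (g : Bool × Bool → ℝ≥0∞) :
    ∫⁻ ω, g (N.arr m t ω, N.acc m t ω) ∂μ
      = ENNReal.ofReal p * (ENNReal.ofReal q * g (true, true)
          + ENNReal.ofReal (1 - q) * g (true, false))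
        + ENNReal.ofReal (1 - p) * (ENNReal.ofReal q * g (false, true)
          + ENNReal.ofReal (1 - q) * g (false, false)) := by
  have hd : Disjoint ({.arr m t} : Set Source) {.acc m t} := by simp
  rw [h.lintegral_comp hd (N.measurable_arr_sigma (Set.mem_singleton _))
    (N.measurable_acc_sigma (Set.mem_singleton _)) (F := fun a b => g (a, b))
    (measurable_of_countable _)]
  simp_rw [fun a => lintegral_bool (h.measurable_acc m t) hq (h.prob_acc m t) fun b => g (a, b)]
  rw [lintegral_bool (h.measurable_arr m t) hp (h.prob_arr m t) fun a =>
    ENNReal.ofReal q * g (a, true) + ENNReal.ofReal (1 - q) * g (a, false)]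

/-- Markov property: the level at time `t` depends on earlier slots only, hence is independent of
the arrival and access decision in slot `t`. -/
theorem IsAloha.lintegral_battery_succ (h : N.IsAloha μ dens p q) (hp : 0 ≤ p) (hp1 : p ≤ 1)
    (hq : 0 ≤ q) (hq1 : q ≤ 1) (m t : ℕ) {f : ℕ → ℝ} (hf : 0 ≤ f) :
    ∫⁻ ω, ENNReal.ofReal (f (N.battery m (t + 1) ω)) ∂μ
      = ∫⁻ ω, ENNReal.ofReal (batteryOp p q f (N.battery m t ω)) ∂μ := by
  have hd : Disjoint (batterySources m t) {.arr m t, .acc m t} := by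
    rw [Set.disjoint_left]
    rintro i (rfl | ⟨s, hs, rfl | rfl⟩) <;> simp <;> omega
  have ha : Measurable[N.sigma {.arr m t, .acc m t}] (N.arr m t) :=
    N.measurable_arr_sigma (by simp)
  have hb : Measurable[N.sigma {.arr m t, .acc m t}] (N.acc m t) :=
    N.measurable_acc_sigma (by simp)
  simp_rw [battery_succ]
  rw [h.lintegral_comp hd (N.measurable_battery_sigma m t) (ha.prodMk hb)
    (F := fun n x => ENNReal.ofReal (f (batteryStep n x))) (measurable_of_countable _)]
  refine lintegral_congr fun ω => ?_
  rw [h.lintegral_arr_acc hp hq m t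
    (fun x => ENNReal.ofReal (f (batteryStep (N.battery m t ω) x)))]
  generalize N.battery m t ω = n
  have hp' := sub_nonneg.2 hp1
  have hq' := sub_nonneg.2 hq1
  have hf' : ∀ n, 0 ≤ f n := hf
  have e1 : batteryStep n (true, true) = max n 1 := by
    unfold batteryStep; split_ifs <;> simp <;> omega
  have e2 : batteryStep n (true, false) = n + 1 := by simp [batteryStep]
  have e3 : batteryStep n (false, true) = n - 1 := by
    unfold batteryStep; split_ifs <;> simp; omega
  have e4 : batteryStep n (false, false) = n := by simp [batteryStep]
  have h1 := hf' (max n 1)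
  have h2 := hf' (n + 1)
  have h3 := hf' (n - 1)
  have h4 := hf' n
  rw [e1, e2, e3, e4, batteryOp_apply, ENNReal.ofReal_add (by positivity) (by positivity),
    ENNReal.ofReal_mul hp, ENNReal.ofReal_mul hp', ENNReal.ofReal_add (by positivity)
    (by positivity), ENNReal.ofReal_add (by positivity) (by positivity), ENNReal.ofReal_mul hq,
    ENNReal.ofReal_mul hq', ENNReal.ofReal_mul hq, ENNReal.ofReal_mul hq']

theorem IsAloha.lintegral_battery (h : N.IsAloha μ dens p q) (hp : 0 ≤ p) (hp1 : p ≤ 1)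
    (hq : 0 ≤ q) (hq1 : q ≤ 1) (m t : ℕ) {f : ℕ → ℝ} (hf : 0 ≤ f) :
    ∫⁻ ω, ENNReal.ofReal (f (N.battery m t ω)) ∂μ
      = ∫⁻ ω, ENNReal.ofReal ((batteryOp p q ^ t) f (N.init m ω)) ∂μ := by
  induction t generalizing f with
  | zero => simp; rfl
  | succ t ih =>
    have hf' : 0 ≤ batteryOp p q f := by
      have := batteryOp_le hp hp1 hq hq1 hf
      rwa [map_zero] at this
    rw [h.lintegral_battery_succ hp hp1 hq hq1 m t hf, ih hf', pow_succ, Module.End.mul_apply]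

theorem IsAloha.measure_battery (h : N.IsAloha μ dens p q) (hp : 0 ≤ p) (hp1 : p ≤ 1)
    (hq : 0 ≤ q) (hq1 : q ≤ 1) (m t : ℕ) :
    μ {ω | 1 ≤ N.battery m t ω}
      = ∫⁻ ω, ENNReal.ofReal ((batteryOp p q ^ t) nonemptyInd (N.init m ω)) ∂μ := by
  rw [← h.lintegral_battery hp hp1 hq hq1 m t nonemptyInd_nonneg]
  have hm : MeasurableSet {ω | 1 ≤ N.battery m t ω} :=
    h.measurable_battery m t measurableSet_Ici
  rw [← lintegral_indicator_one hm]
  refine lintegral_congr fun ω => ?_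
  by_cases hω : 1 ≤ N.battery m t ω <;> simp [nonemptyInd, hω]

/-- The limit is the same from every initial level, so dominated convergence averages it over an
arbitrary initial law. -/
theorem IsAloha.tendsto_energyProb (h : N.IsAloha μ dens p q) (hp : 0 ≤ p) (hp1 : p ≤ 1)
    (hq : 0 < q) (hq1 : q ≤ 1) (m : ℕ) :
    Tendsto (fun t => N.energyProb μ m t) atTop (𝓝 (min (p / q) 1)) := by
  have hr : 0 ≤ min (p / q) 1 := le_min (div_nonneg hp hq.le) zero_le_one
  have key : Tendsto (fun t => μ {ω | 1 ≤ N.battery m t ω}) atTop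
      (𝓝 (ENNReal.ofReal (min (p / q) 1))) := by
    simp_rw [h.measure_battery hp hp1 hq.le hq1 m]
    have hlim : ENNReal.ofReal (min (p / q) 1)
        = ∫⁻ _ : Ω, ENNReal.ofReal (min (p / q) 1) ∂μ := by simp
    rw [hlim]
    refine tendsto_lintegral_of_dominated_convergence (fun _ => 1) (fun t => ?_) (fun t => ?_)
      (by simp) ?_
    · exact (measurable_from_top (f := fun n =>
        ENNReal.ofReal ((batteryOp p q ^ t) nonemptyInd n))).comp (h.measurable_init m)
    · refine ae_of_all _ fun ω => ?_
      simpa using batteryOp_pow_ind_le_one hp hp1 hq.le hq1 t (N.init m ω)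
    · refine ae_of_all _ fun ω => ?_
      exact ENNReal.tendsto_ofReal (tendsto_batteryOp_pow_ind hp hp1 hq.le hq1 hq (N.init m ω))
  have := (ENNReal.tendsto_toReal ENNReal.ofReal_ne_top).comp key
  rwa [ENNReal.toReal_ofReal hr] at this

theorem IsAloha.measure_battery_eq (h : N.IsAloha μ dens p q) (hp : 0 ≤ p) (hp1 : p ≤ 1)
    (hq : 0 ≤ q) (hq1 : q ≤ 1) (m t : ℕ) :
    μ {ω | 1 ≤ N.battery m t ω} = ENNReal.ofReal (N.energyProb μ 0 t) := by
  rw [energyProb, measureReal_def, ENNReal.ofReal_toReal (measure_ne_top _ _),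
    h.measure_battery hp hp1 hq hq1, h.measure_battery hp hp1 hq hq1]
  exact ((h.ident_init m).comp (measurable_from_top (f := fun n =>
    ENNReal.ofReal ((batteryOp p q ^ t) nonemptyInd n)))).lintegral_eq

/-- The sources that determine whether transmitter `m` is active in slot `t`. -/
def activeSources (m t : ℕ) : Set Source := batterySources m (t + 1)

omit mΩ in
theorem measurableSet_active_sigma (N : Network Ω) (m t : ℕ) :
    MeasurableSet[N.sigma (activeSources m t)] {ω | N.Active m t ω} := by
  have h1 : Measurable[N.sigma (activeSources m t)] (N.battery m t) :=
    (N.measurable_battery_sigma m t).mono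
      (N.sigma_mono (batterySources_mono m t.le_succ)) le_rfl
  have h3 : Measurable[N.sigma (activeSources m t)] (N.acc m t) :=
    N.measurable_acc_sigma (.inr ⟨t, t.lt_succ_self, .inr rfl⟩)
  exact (h1 measurableSet_Ici).inter (h3 (measurableSet_singleton true))

theorem IsAloha.measure_active (h : N.IsAloha μ dens p q) (hp : 0 ≤ p) (hp1 : p ≤ 1)
    (hq : 0 ≤ q) (hq1 : q ≤ 1) (m t : ℕ) :
    μ {ω | N.Active m t ω} = ENNReal.ofReal (N.energyProb μ 0 t * q) := by
  -- The access decision in slot `t` does not enter the level at time `t`, which makes the two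
  -- conditions for activity independent.
  have hd : Disjoint (batterySources m t) {.acc m t} := by
    rw [Set.disjoint_left]
    rintro i (rfl | ⟨s, hs, rfl | rfl⟩) <;> simp; omega
  have hi := (Indep_iff _ _ μ).1 (h.indep_sigma hd) {ω | 1 ≤ N.battery m t ω}
    {ω | N.acc m t ω = true} (N.measurable_battery_sigma m t measurableSet_Ici)
    (N.measurable_acc_sigma (Set.mem_singleton _) (measurableSet_singleton true))
  have h0 : 0 ≤ N.energyProb μ 0 t := measureReal_nonneg
  rw [ENNReal.ofReal_mul h0, ← h.measure_battery_eq hp hp1 hq hq1 m t,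
    ← h.prob_acc m t, ← hi]
  rfl

end Network

end EnergyHarvesting

namespace EnergyHarvesting

/-! ### The function `exp (-x)` on `[0, ∞]` -/

/-- `exp (-x)` for `x ∈ [0, ∞]`. -/
noncomputable def expNeg (x : ℝ≥0∞) : ℝ≥0∞ := EReal.exp (-(x : EReal))

@[simp] theorem expNeg_zero : expNeg 0 = 1 := by simp [expNeg]

@[simp] theorem expNeg_top : expNeg ∞ = 0 := by simp [expNeg]

theorem expNeg_ofReal {x : ℝ} (hx : 0 ≤ x) :
    expNeg (ENNReal.ofReal x) = ENNReal.ofReal (Real.exp (-x)) := by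
  rw [expNeg, EReal.coe_ennreal_ofReal, max_eq_left hx, ← EReal.coe_neg, EReal.exp_coe]

theorem expNeg_add (x y : ℝ≥0∞) : expNeg (x + y) = expNeg x * expNeg y := by
  rw [expNeg, EReal.coe_ennreal_add, EReal.neg_add (by simp) (by simp), sub_eq_add_neg,
    EReal.exp_add, expNeg, expNeg]

theorem expNeg_sum {ι : Type*} (s : Finset ι) (f : ι → ℝ≥0∞) :
    expNeg (∑ i ∈ s, f i) = ∏ i ∈ s, expNeg (f i) := by
  classical
  induction s using Finset.induction_on with
  | empty => simp
  | insert a s ha ih => rw [Finset.sum_insert ha, Finset.prod_insert ha, expNeg_add, ih]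

theorem expNeg_antitone : Antitone expNeg := fun x y h => by
  unfold expNeg
  exact EReal.exp_monotone (EReal.neg_le_neg_iff.2 (EReal.coe_ennreal_le_coe_ennreal_iff.2 h))

theorem expNeg_le_one (x : ℝ≥0∞) : expNeg x ≤ 1 := by
  simpa using expNeg_antitone (zero_le (a := x))

theorem continuous_expNeg : Continuous expNeg :=
  EReal.expHomeomorph.continuous.comp (continuous_neg.comp continuous_coe_ennreal_ereal)

theorem measurable_expNeg : Measurable expNeg := continuous_expNeg.measurable

/-- Continuity includes the point `∞`, so Laplace transforms pass to monotone limits without knowing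
that the interference is finite. -/
theorem expNeg_iSup {ι : Type*} [Nonempty ι] (f : ι → ℝ≥0∞) :
    expNeg (⨆ i, f i) = ⨅ i, expNeg (f i) :=
  expNeg_antitone.map_ciSup_of_continuousAt continuous_expNeg.continuousAt (OrderTop.bddAbove _)

theorem expNeg_tsum (f : ℕ → ℝ≥0∞) :
    expNeg (∑' s, f s) = ⨅ n, ∏ s ∈ Finset.range n, expNeg (f s) := by
  rw [ENNReal.tsum_eq_iSup_nat, expNeg_iSup]
  simp_rw [expNeg_sum]

/-! ### Moments of Poisson counts -/

theorem tsum_poisson_pow (r : NNReal) {c : ℝ≥0∞} (hc : c ≤ 1) :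
    ∑' n : ℕ, poissonMeasure r {n} * c ^ n = expNeg (r * (1 - c)) := by
  have hct : c ≠ ∞ := ne_top_of_le_ne_top ENNReal.one_ne_top hc
  lift c to NNReal using hct
  have hc' : (c : ℝ) ≤ 1 := by exact_mod_cast hc
  have h1 : (r : ℝ≥0∞) * (1 - c) = ENNReal.ofReal (r * (1 - c)) := by
    rw [ENNReal.ofReal_mul r.coe_nonneg, ENNReal.ofReal_sub _ c.coe_nonneg]; simp
  have hs : HasSum (fun n : ℕ => Real.exp (-r) * r ^ n / n.factorial * (c : ℝ) ^ n)
      (Real.exp (-(r * (1 - c)))) := by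
    have := (NormedSpace.expSeries_div_hasSum_exp ((r : ℝ) * c)).mul_left (Real.exp (-r))
    rw [← Real.exp_eq_exp_ℝ, ← Real.exp_add] at this
    have e1 : (fun n : ℕ => Real.exp (-r) * r ^ n / n.factorial * (c : ℝ) ^ n)
        = fun n : ℕ => Real.exp (-r) * (((r : ℝ) * c) ^ n / n.factorial) := by
      ext n; rw [mul_pow]; ring
    have e2 : -((r : ℝ) * (1 - c)) = -r + r * c := by ring
    rwa [e1, e2]
  rw [h1, expNeg_ofReal (mul_nonneg r.coe_nonneg (sub_nonneg.2 hc')), ← hs.tsum_eq,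
    ENNReal.ofReal_tsum_of_nonneg (fun n => by positivity) hs.summable]
  refine tsum_congr fun n => ?_
  rw [poissonMeasure_singleton, ENNReal.ofReal_mul (by positivity),
    ENNReal.ofReal_pow c.coe_nonneg, ENNReal.ofReal_coe_nnreal]

/-- Size biasing: Poisson weights `π` satisfy `(n + 1) π (n + 1) = r π n`, so marking one point and
removing it leaves a Poisson count. This is Mecke's formula for a single cell. -/
theorem tsum_poisson_mul_pow (r : NNReal) {c : ℝ≥0∞} (hc : c ≤ 1) :
    ∑' n : ℕ, poissonMeasure r {n} * (n * c ^ (n - 1)) = r * expNeg (r * (1 - c)) := by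
  rw [← tsum_poisson_pow r hc, _root_.tsum_eq_zero_add' ENNReal.summable, ← ENNReal.tsum_mul_left]
  simp only [Nat.cast_zero, zero_mul, mul_zero, zero_add, Nat.add_sub_cancel]
  refine tsum_congr fun n => ?_
  have : poissonMeasure r {n + 1} * ((n + 1 : ℕ) : ℝ≥0∞) = r * poissonMeasure r {n} := by
    rw [poissonMeasure_singleton, poissonMeasure_singleton, ← ENNReal.ofReal_natCast (n + 1),
      ← ENNReal.ofReal_mul (by positivity), ← ENNReal.ofReal_coe_nnreal (p := r),
      ← ENNReal.ofReal_mul (by positivity)]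
    congr 1
    rw [Nat.factorial_succ]
    push_cast
    field_simp
    ring
  rw [← mul_assoc, this, mul_assoc]

theorem ae_ne_top_of_poisson {Ω : Type*} [MeasurableSpace Ω] {μ : Measure Ω}
    [IsProbabilityMeasure μ] {X : Ω → ℕ∞} (hX : Measurable X) {r : NNReal}
    (h : ∀ n : ℕ, μ {ω | X ω = n} = poissonMeasure r {n}) : ∀ᵐ ω ∂μ, X ω ≠ ⊤ := by
  have htot : ∑' n : ℕ, poissonMeasure r {n} = 1 := by
    have := lintegral_countable' (μ := poissonMeasure r) (fun _ => 1)
    simpa using this.symm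
  have hm : ∀ n : ℕ, MeasurableSet {ω | X ω = n} := fun n => hX (measurableSet_singleton _)
  have hU : μ (⋃ n : ℕ, {ω | X ω = n}) = 1 := by
    rw [measure_iUnion _ hm]
    · simp_rw [h]; exact htot
    · intro i j hij
      refine Set.disjoint_left.2 fun ω hi hj => hij ?_
      simp only [Set.mem_ofPred_eq] at hi hj
      exact_mod_cast hi.symm.trans hj
  have := (prob_compl_eq_zero_iff (MeasurableSet.iUnion hm)).2 hU
  rw [ae_iff]
  refine measure_mono_null ?_ this
  intro ω hω
  simp only [ne_eq, not_not, Set.mem_ofPred_eq] at hω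
  simp [hω]

/-- Lebesgue integral of a function of an extended-natural random variable with Poisson law. -/
theorem lintegral_comp_of_poisson {Ω : Type*} [MeasurableSpace Ω] {μ : Measure Ω}
    [IsProbabilityMeasure μ] {X : Ω → ℕ∞} (hX : Measurable X) {r : NNReal}
    (h : ∀ n : ℕ, μ {ω | X ω = n} = poissonMeasure r {n}) (φ : ℕ → ℝ≥0∞) :
    ∫⁻ ω, φ (X ω).toNat ∂μ = ∑' n, poissonMeasure r {n} * φ n := by
  have hm : ∀ n : ℕ, MeasurableSet {ω | X ω = n} := fun n => hX (measurableSet_singleton _)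
  have hae := ae_ne_top_of_poisson hX h
  have : ∀ᵐ ω ∂μ, φ (X ω).toNat = ∑' n : ℕ, {ω | X ω = n}.indicator (fun _ => φ n) ω := by
    filter_upwards [hae] with ω hω
    rw [tsum_eq_single (X ω).toNat]
    · rw [Set.indicator_of_mem]
      simp [ENat.natCast_toNat hω]
    · intro n hn
      rw [Set.indicator_of_notMem]
      simp only [Set.mem_ofPred_eq]
      intro hXn
      exact hn (by rw [hXn, ENat.toNat_natCast])
  rw [lintegral_congr_ae this, lintegral_tsum fun n =>
    (measurable_const.indicator (hm n)).aemeasurable]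
  refine tsum_congr fun n => ?_
  rw [lintegral_indicator_const (hm n), h, mul_comm]

theorem measurable_pointCount {Ω : Type*} [MeasurableSpace Ω] {T : ℕ → Ω → Plane}
    (hT : ∀ m, Measurable (T m)) {B : Set Plane} (hB : MeasurableSet B) :
    Measurable (pointCount T B) := by
  have h : ∀ ω, (pointCount T B ω : ℝ≥0∞) = ∑' m, (T m ⁻¹' B).indicator 1 ω := by
    intro ω
    rw [pointCount, ← ENNReal.tsum_set_one]
    exact tsum_subtype {m | T m ω ∈ B} (fun _ => (1 : ℝ≥0∞))
  have hm : Measurable fun ω => (pointCount T B ω : ℝ≥0∞) := by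
    simp_rw [h]
    exact Measurable.tsum fun m => measurable_one.indicator (hT m hB)
  refine measurable_to_countable' fun n => ?_
  have : pointCount T B ⁻¹' {n} = (fun ω => (pointCount T B ω : ℝ≥0∞)) ⁻¹' {(n : ℝ≥0∞)} := by
    ext ω; simp
  rw [this]
  exact hm (measurableSet_singleton _)

/-! ### Products over the points of a configuration -/

/-- The product of `g s` over all indices `s ≠ m`, for factors `g s ≤ 1`. -/
noncomputable def prodExcept (m : ℕ) (g : ℕ → ℝ≥0∞) : ℝ≥0∞ :=
  ⨅ n, ∏ s ∈ (Finset.range n).erase m, g s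

theorem prodExcept_eq_prod {m : ℕ} {g : ℕ → ℝ≥0∞} (hg : ∀ s, g s ≤ 1) (S : Finset ℕ)
    (hS : ∀ s ∉ S, g s = 1) : prodExcept m g = ∏ s ∈ S.erase m, g s := by
  apply le_antisymm
  · obtain ⟨n, hn⟩ := S.exists_nat_subset_range
    refine (iInf_le _ n).trans_eq (Finset.prod_subset (Finset.erase_subset_erase m hn) ?_).symm
    intro s hs hs'
    refine hS s fun h => hs' (Finset.mem_erase.2 ⟨(Finset.mem_erase.1 hs).1, h⟩)
  · refine le_iInf fun n => ?_
    have h1 : ∏ s ∈ S.erase m, g s = ∏ s ∈ (S ∪ Finset.range n).erase m, g s := by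
      refine Finset.prod_subset (Finset.erase_subset_erase m Finset.subset_union_left) ?_
      intro s hs hs'
      exact hS s fun h => hs' (Finset.mem_erase.2 ⟨(Finset.mem_erase.1 hs).1, h⟩)
    rw [h1]
    exact Finset.prod_le_prod_of_subset_of_le_one'
      (Finset.erase_subset_erase m Finset.subset_union_right) fun s _ _ => hg s

theorem measurable_prodExcept {Ω : Type*} [MeasurableSpace Ω] (m : ℕ) {g : Ω → ℕ → ℝ≥0∞}
    (hg : ∀ s, Measurable fun ω => g ω s) : Measurable fun ω => prodExcept m (g ω) :=
  Measurable.iInf fun _ => Finset.measurable_prod _ fun s _ => hg s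

theorem prodExcept_iInf (m : ℕ) {g : ℕ → ℕ → ℝ≥0∞} (hanti : ∀ s, Antitone fun n => g n s)
    (hg : ∀ n s, g n s ≤ 1) :
    prodExcept m (fun s => ⨅ n, g n s) = ⨅ n, prodExcept m (g n) := by
  unfold prodExcept
  rw [iInf_comm]
  refine iInf_congr fun k => ?_
  have h1 : Tendsto (fun n => ∏ s ∈ (Finset.range k).erase m, g n s) atTop
      (𝓝 (∏ s ∈ (Finset.range k).erase m, ⨅ n, g n s)) :=
    ENNReal.tendsto_finsetProd_of_ne_top _ (fun s _ => tendsto_atTop_iInf (hanti s))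
      fun s _ => ne_top_of_le_ne_top ENNReal.one_ne_top ((iInf_le _ 0).trans (hg 0 s))
  have h2 : Antitone fun n => ∏ s ∈ (Finset.range k).erase m, g n s :=
    fun a b hab => Finset.prod_le_prod' fun s _ => hanti s hab
  exact tendsto_nhds_unique h1 (tendsto_atTop_iInf h2)

end EnergyHarvesting

namespace EnergyHarvesting

/-! ### Mecke's formula for a Poisson process -/

/-- The product depends only on how many points carry each label. Each point labelled `j` gives the
same term, with one factor `C j` removed. The truncated exponent is harmless because it is
multiplied by the count. -/
theorem tsum_prodExcept_label {β : Type*} [DecidableEq β] (y : ℕ → β) (R : Finset β)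
    (hfin : ∀ v ∈ R, {s | y s = v}.Finite) {C : β → ℝ≥0∞} (hC : ∀ v, C v ≤ 1)
    (hC1 : ∀ v ∉ R, C v = 1) {j : β} (hj : j ∈ R) :
    ∑' m, (if y m = j then prodExcept m (fun s => C (y s)) else 0)
      = ∏ v ∈ R, if v = j then
          ({s | y s = v}.ncard : ℝ≥0∞) * C v ^ ({s | y s = v}.ncard - 1)
        else C v ^ {s | y s = v}.ncard := by
  classical
  have hS : {s | y s ∈ R}.Finite := by
    have : {s | y s ∈ R} = ⋃ v ∈ R, {s | y s = v} := by ext; simp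
    rw [this]
    exact R.finite_toSet.biUnion hfin
  set S := hS.toFinset with hSdef
  have hmem : ∀ s, s ∈ S ↔ y s ∈ R := fun s => by simp [S]
  have hcard : ∀ v ∈ R, {s | y s = v}.ncard = (S.filter fun s => y s = v).card := by
    intro v hv
    rw [← Set.ncard_coe_finset]
    congr 1
    ext s
    simp only [Set.mem_ofPred_eq, Finset.coe_filter, hmem]
    constructor
    · rintro rfl; exact ⟨hv, rfl⟩
    · exact fun h => h.2
  have hprod : ∀ m, y m = j → prodExcept m (fun s => C (y s))
      = ∏ v ∈ R, C v ^ (if v = j then {s | y s = v}.ncard - 1 else {s | y s = v}.ncard) := by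
    intro m hm
    rw [prodExcept_eq_prod (fun s => hC _) S fun s hs => hC1 _ fun h => hs ((hmem s).2 h)]
    rw [← Finset.prod_fiberwise_of_maps_to (t := R) (g := y)
      fun s hs => (hmem s).1 (Finset.mem_of_mem_erase hs)]
    refine Finset.prod_congr rfl fun v hv => ?_
    rw [Finset.prod_congr rfl (g := fun _ => C v)
      (fun s hs => by rw [(Finset.mem_filter.1 hs).2]), Finset.prod_const, hcard v hv,
      Finset.filter_erase]
    congr 1
    split_ifs with hvj
    · rw [Finset.card_erase_of_mem]
      rw [Finset.mem_filter, hmem, hm, hvj]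
      exact ⟨hj, rfl⟩
    · rw [Finset.erase_eq_of_notMem]
      rw [Finset.mem_filter, hm]
      exact fun h => hvj h.2.symm
  have h1 : ∀ m, (if y m = j then prodExcept m (fun s => C (y s)) else 0)
      = if y m = j then
        ∏ v ∈ R, C v ^ (if v = j then {s | y s = v}.ncard - 1 else {s | y s = v}.ncard) else 0 := by
    intro m
    split_ifs with hm
    · exact hprod m hm
    · rfl
  simp_rw [h1]
  rw [tsum_eq_sum (s := S.filter fun s => y s = j), ← Finset.sum_filter, Finset.filter_filter]
  · simp only [and_self]
    rw [Finset.sum_const, ← hcard j hj, nsmul_eq_mul, ← Finset.mul_prod_erase R _ hj,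
      ← Finset.mul_prod_erase R _ hj, ← mul_assoc, if_pos rfl, if_pos rfl]
    congr 1
    refine Finset.prod_congr rfl fun v hv => ?_
    rw [if_neg (Finset.ne_of_mem_erase hv), if_neg (Finset.ne_of_mem_erase hv)]
  · intro m hm
    rw [if_neg]
    intro h
    exact hm (Finset.mem_filter.2 ⟨(hmem m).2 (h ▸ hj), h⟩)

variable {Ω : Type*} [MeasurableSpace Ω] {μ : Measure Ω} [IsProbabilityMeasure μ] {dens : ℝ}
  {T : ℕ → Ω → Plane}

omit [IsProbabilityMeasure μ] in
theorem IsPoissonProcess.iIndepFun_finset {dens : ℝ} (h : IsPoissonProcess μ dens T) {ι : Type*}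
    [Finite ι] {B : ι → Set Plane} (hB : ∀ i, MeasurableSet (B i)) (hv : ∀ i, volume (B i) ≠ ∞)
    (hd : Pairwise (fun i j => Disjoint (B i) (B j))) :
    iIndepFun (fun i => pointCount T (B i)) μ := by
  obtain ⟨n, ⟨e⟩⟩ := Finite.exists_equiv_fin ι
  have := h.indep n (fun i => B (e.symm i)) (fun i => hB _) (fun i => hv _)
    (fun i j hij => hd (e.symm.injective.ne hij))
  have h2 := this.precomp e.injective
  simpa using h2

/-- Counts in the disjoint cells are independent, so the expectation factorizes: the cell `j` gives
a size-biased generating function, every other cell an ordinary one. -/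
theorem IsPoissonProcess.tsum_lintegral_label (h : IsPoissonProcess μ dens T) (hd : 0 ≤ dens)
    {β : Type*} (g : Plane → β) (R : Finset β) (hm : ∀ v ∈ R, MeasurableSet (g ⁻¹' {v}))
    (hv : ∀ v ∈ R, volume (g ⁻¹' {v}) ≠ ∞) {C : β → ℝ≥0∞} (hC : ∀ v, C v ≤ 1)
    (hC1 : ∀ v ∉ R, C v = 1) (hCg : Measurable fun x => C (g x)) {j : β} (hj : j ∈ R) :
    ∑' m, ∫⁻ ω in T m ⁻¹' (g ⁻¹' {j}), prodExcept m (fun s => C (g (T s ω))) ∂μ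
      = ENNReal.ofReal dens * volume (g ⁻¹' {j})
        * expNeg (ENNReal.ofReal dens * ∑ v ∈ R, (1 - C v) * volume (g ⁻¹' {v})) := by
  classical
  have hT := h.measurable
  set N : β → Ω → ℕ∞ := fun v => pointCount T (g ⁻¹' {v}) with hN
  have hNm : ∀ v ∈ R, Measurable (N v) := fun v hvR => measurable_pointCount hT (hm v hvR)
  have hNp : ∀ v ∈ R, ∀ n : ℕ, μ {ω | N v ω = n}
      = poissonMeasure (dens * volume.real (g ⁻¹' {v})).toNNReal {n} :=
    fun v hvR => h.poisson _ (hm v hvR) (hv v hvR)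
  set φ : β → ℕ → ℝ≥0∞ := fun v n => if v = j then n * C v ^ (n - 1) else C v ^ n with hφ
  have hpt : ∀ᵐ ω ∂μ, ∑' m, (T m ⁻¹' (g ⁻¹' {j})).indicator
      (fun ω => prodExcept m (fun s => C (g (T s ω)))) ω = ∏ v ∈ R, φ v (N v ω).toNat := by
    have hfin : ∀ᵐ ω ∂μ, ∀ v ∈ R, N v ω ≠ ⊤ :=
      (Finset.eventually_all R).2 fun v hvR => ae_ne_top_of_poisson (hNm v hvR) (hNp v hvR)
    filter_upwards [hfin] with ω hω
    exact tsum_prodExcept_label (fun s => g (T s ω)) R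
      (fun v hvR => Set.encard_ne_top_iff.1 (hω v hvR)) hC hC1 hj
  have hind : iIndepFun (fun v : R => N v) μ :=
    h.iIndepFun_finset (fun v => hm v v.2) (fun v => hv v v.2) fun v w hvw => by
      refine Set.disjoint_left.2 fun x hx hx' => hvw (Subtype.ext ?_)
      simp only [Set.mem_preimage, Set.mem_singleton_iff] at hx hx'
      rw [← hx, ← hx']
  have hmφ : ∀ v : R, Measurable fun n : ℕ∞ => φ v n.toNat := fun v => measurable_from_top
  have hprod : ∫⁻ ω, ∏ v ∈ R, φ v (N v ω).toNat ∂μ = ∏ v ∈ R, ∫⁻ ω, φ v (N v ω).toNat ∂μ := by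
    have := lintegral_prod_eq_prod_lintegral_of_indepFun Finset.univ
      (fun (v : R) ω => φ v (N v ω).toNat) (hind.comp (fun v n => φ v n.toNat) hmφ)
      (fun v => (hmφ v).comp (hNm v v.2))
    simp_rw [Finset.univ_eq_attach] at this
    rw [← Finset.prod_attach R]
    rw [← this]
    refine lintegral_congr fun ω => ?_
    rw [← Finset.prod_attach R]
  have hr : ∀ v ∈ R, (((dens * volume.real (g ⁻¹' {v})).toNNReal : NNReal) : ℝ≥0∞)
      = ENNReal.ofReal dens * volume (g ⁻¹' {v}) := by
    intro v hvR
    change ENNReal.ofReal _ = _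
    rw [ENNReal.ofReal_mul hd, measureReal_def, ENNReal.ofReal_toReal (hv v hvR)]
  have hval : ∀ v ∈ R, ∫⁻ ω, φ v (N v ω).toNat ∂μ
      = (if v = j then ENNReal.ofReal dens * volume (g ⁻¹' {v}) else 1)
        * expNeg (ENNReal.ofReal dens * ((1 - C v) * volume (g ⁻¹' {v}))) := by
    intro v hvR
    rw [lintegral_comp_of_poisson (hNm v hvR) (hNp v hvR)]
    have e : ENNReal.ofReal dens * ((1 - C v) * volume (g ⁻¹' {v}))
        = ENNReal.ofReal dens * volume (g ⁻¹' {v}) * (1 - C v) := by ring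
    rw [e]
    simp only [hφ]
    split_ifs with hvj
    · rw [tsum_poisson_mul_pow _ (hC v), hr v hvR]
    · rw [tsum_poisson_pow _ (hC v), hr v hvR, one_mul]
  have hmeas : ∀ m, Measurable ((T m ⁻¹' (g ⁻¹' {j})).indicator
      (fun ω => prodExcept m (fun s => C (g (T s ω))))) := fun m =>
    (measurable_prodExcept m fun s => hCg.comp (hT s)).indicator (hT m (hm j hj))
  calc ∑' m, ∫⁻ ω in T m ⁻¹' (g ⁻¹' {j}), prodExcept m (fun s => C (g (T s ω))) ∂μ
      = ∑' m, ∫⁻ ω, (T m ⁻¹' (g ⁻¹' {j})).indicator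
          (fun ω => prodExcept m (fun s => C (g (T s ω)))) ω ∂μ :=
        tsum_congr fun m => (lintegral_indicator (hT m (hm j hj)) _).symm
    _ = ∏ v ∈ R, ∫⁻ ω, φ v (N v ω).toNat ∂μ := by
        rw [← lintegral_tsum fun m => (hmeas m).aemeasurable, lintegral_congr_ae hpt, hprod]
    _ = _ := by
        rw [Finset.prod_congr rfl hval, Finset.prod_mul_distrib, Finset.prod_ite_eq' R j,
          if_pos hj, Finset.mul_sum, expNeg_sum]

/-- Mecke's formula for the functional `∏ (1 - f x y)` of the remaining points `y`, for points `x`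
in `A`. -/
def HasMecke (μ : Measure Ω) (dens : ℝ) (T : ℕ → Ω → Plane) (A : Set Plane)
    (f : Plane → Plane → ℝ≥0∞) : Prop :=
  ∑' m, ∫⁻ ω in T m ⁻¹' A, prodExcept m (fun s => 1 - f (T m ω) (T s ω)) ∂μ
    = ENNReal.ofReal dens * ∫⁻ x in A, expNeg (ENNReal.ofReal dens * ∫⁻ y, f x y)

theorem IsPoissonProcess.hasMecke_simpleFunc (h : IsPoissonProcess μ dens T) (hd : 0 ≤ dens)
    {A : Set Plane} (hA : MeasurableSet A) (hAv : volume A ≠ ∞) (f : SimpleFunc Plane ℝ≥0∞)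
    (hf1 : ∀ x, f x ≤ 1) (hfv : volume {x | f x ≠ 0} ≠ ∞) :
    HasMecke μ dens T A fun _ y => f y := by
  classical
  have hT := h.measurable
  let a : SimpleFunc Plane ℝ≥0∞ := SimpleFunc.piecewise A hA (SimpleFunc.const _ 1) 0
  have ha : ∀ x, a x = A.indicator 1 x := fun x => by
    simp only [a, SimpleFunc.coe_piecewise, Set.piecewise, Set.indicator]; rfl
  -- Pairing with the indicator of `A` makes `A` a union of fibres, so a mass on `A` is the sum of
  -- the fibre masses weighted by the first coordinate.
  let g : SimpleFunc Plane (ℝ≥0∞ × ℝ≥0∞) := a.pair f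
  have hg : ∀ x, g x = (a x, f x) := fun x => rfl
  -- The zero label may have a fibre of infinite volume. It can be dropped: it lies outside `A` and
  -- its factor `1 - f` is `1`.
  let R := g.range.filter fun v => v ≠ 0
  have hm : ∀ v, MeasurableSet (g ⁻¹' {v}) := fun v => g.measurableSet_fiber v
  have hv : ∀ v ∈ R, volume (g ⁻¹' {v}) ≠ ∞ := by
    intro v hvR
    refine ne_top_of_le_ne_top (ENNReal.add_ne_top.2 ⟨hAv, hfv⟩)
      ((measure_mono ?_).trans (measure_union_le A {x | f x ≠ 0}))
    rintro x rfl
    by_contra hx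
    simp only [Set.mem_union, not_or, Set.mem_ofPred_eq, not_not] at hx
    refine (Finset.mem_filter.1 hvR).2 ?_
    rw [hg, ha, Set.indicator_of_notMem hx.1, hx.2]
    rfl
  let C : ℝ≥0∞ × ℝ≥0∞ → ℝ≥0∞ := fun v => if v ∈ R then 1 - v.2 else 1
  have hCg : ∀ x, C (g x) = 1 - f x := by
    intro x
    simp only [C]
    split_ifs with hx
    · rfl
    · have : g x = 0 := by
        by_contra h0
        exact hx (Finset.mem_filter.2 ⟨g.mem_range_self x, h0⟩)
      have : f x = 0 := congrArg Prod.snd this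
      simp [this]
  have hC : ∀ v, C v ≤ 1 := fun v => by
    simp only [C]; split_ifs
    · exact tsub_le_self
    · exact le_rfl
  have hv2 : ∀ v ∈ R, 1 - C v = v.2 := by
    intro v hvR
    obtain ⟨x, rfl⟩ := SimpleFunc.mem_range.1 (Finset.mem_filter.1 hvR).1
    rw [hCg, hg]
    exact ENNReal.sub_sub_cancel ENNReal.one_ne_top (hf1 x)
  have hlab : ∀ v ∈ R, ∑' m, ∫⁻ ω in T m ⁻¹' (g ⁻¹' {v}),
      prodExcept m (fun s => 1 - f (T s ω)) ∂μ
      = ENNReal.ofReal dens * volume (g ⁻¹' {v})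
        * expNeg (ENNReal.ofReal dens * ∫⁻ y, f y) := by
    intro v hvR
    have hCm : Measurable fun x => C (g x) := by
      simp_rw [hCg]; exact measurable_const.sub f.measurable
    have := h.tsum_lintegral_label hd g R (fun v _ => hm v) hv hC
      (fun v hv' => by simp only [C]; rw [if_neg hv']) hCm hvR
    simp_rw [hCg] at this
    rw [this]
    congr 3
    rw [Finset.sum_congr rfl fun v hv' => by rw [hv2 v hv']]
    have e1 : ∫⁻ y, f y = (g.map Prod.snd).lintegral volume := by
      rw [← SimpleFunc.lintegral_eq_lintegral]; rfl
    rw [e1, SimpleFunc.map_lintegral, Finset.sum_filter]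
    refine Finset.sum_congr rfl fun v _ => ?_
    split_ifs with h0
    · rfl
    · simp only [ne_eq, not_not] at h0; simp [h0]
  have hdec : ∀ (ν : Measure Plane) , ν A = ∑ v ∈ R, v.1 * ν (g ⁻¹' {v}) := by
    intro ν
    have e1 : ν A = (g.map Prod.fst).lintegral ν := by
      rw [← SimpleFunc.lintegral_eq_lintegral, ← lintegral_indicator_one hA]
      exact lintegral_congr fun x => (ha x).symm
    rw [e1, SimpleFunc.map_lintegral, Finset.sum_filter]
    refine Finset.sum_congr rfl fun v _ => ?_
    split_ifs with h0
    · rfl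
    · simp only [ne_eq, not_not] at h0; simp [h0]
  have hleft : ∀ m, ∫⁻ ω in T m ⁻¹' A, prodExcept m (fun s => 1 - f (T s ω)) ∂μ
      = ∑ v ∈ R, v.1 * ∫⁻ ω in T m ⁻¹' (g ⁻¹' {v}),
        prodExcept m (fun s => 1 - f (T s ω)) ∂μ := by
    intro m
    -- Weighting by the product and pushing forward to the plane turns the restricted integral into
    -- the mass of `A`, which is then split into fibres.
    have := hdec ((μ.withDensity fun ω => prodExcept m (fun s => 1 - f (T s ω))).map (T m))
    rw [Measure.map_apply (hT m) hA, withDensity_apply _ (hT m hA)] at this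
    rw [this]
    refine Finset.sum_congr rfl fun v _ => ?_
    rw [Measure.map_apply (hT m) (hm v), withDensity_apply _ (hT m (hm v))]
  unfold HasMecke
  simp_rw [hleft]
  rw [Summable.tsum_finsetSum fun _ _ => ENNReal.summable]
  simp_rw [ENNReal.tsum_mul_left]
  rw [Finset.sum_congr rfl fun v hvR => by rw [hlab v hvR], setLIntegral_const, hdec volume,
    Finset.mul_sum, Finset.mul_sum]
  exact Finset.sum_congr rfl fun v _ => by ring

end EnergyHarvesting

/-! ### Mecke's formula: monotone limits and dependence on the marked point -/

namespace EnergyHarvesting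

variable {Ω : Type*} [MeasurableSpace Ω] {μ : Measure Ω} [IsProbabilityMeasure μ] {dens : ℝ}
  {T : ℕ → Ω → Plane}

theorem tsum_lintegral_iInf {F : ℕ → ℕ → Ω → ℝ≥0∞} (hF : ∀ n m, Measurable (F n m))
    (hanti : ∀ m, Antitone fun n => F n m) {ν : ℕ → Measure Ω}
    (hfin : ∑' m, ∫⁻ ω, F 0 m ω ∂(ν m) ≠ ∞) :
    ∑' m, ∫⁻ ω, ⨅ n, F n m ω ∂(ν m) = ⨅ n, ∑' m, ∫⁻ ω, F n m ω ∂(ν m) := by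
  have h1 : ∀ m, ∫⁻ ω, ⨅ n, F n m ω ∂(ν m) = ⨅ n, ∫⁻ ω, F n m ω ∂(ν m) := fun m =>
    lintegral_iInf (fun n => hF n m) (hanti m) (ENNReal.ne_top_of_tsum_ne_top hfin m)
  simp_rw [h1]
  simp_rw [← lintegral_count]
  rw [lintegral_iInf (f := fun n m => ∫⁻ ω, F n m ω ∂(ν m)) (fun n => measurable_from_top)
    (fun a b hab m => lintegral_mono (hanti m hab))]
  rwa [lintegral_count]

-- Both sides decrease as `f` increases. Downward monotone convergence needs a finite starting
-- value: for the volume side it comes from `expNeg ≤ 1` and the finite volume of `A`, and the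
-- formula for `f 0` transfers it to the sum.
omit [IsProbabilityMeasure μ] in
theorem HasMecke.iSup {A : Set Plane} (hAv : volume A ≠ ∞)
    (hT : ∀ m, Measurable (T m)) {f : ℕ → Plane → Plane → ℝ≥0∞}
    (hfm : ∀ n, Measurable (Function.uncurry (f n))) (hmono : Monotone f)
    (h : ∀ n, HasMecke μ dens T A (f n)) :
    HasMecke μ dens T A fun x y => ⨆ n, f n x y := by
  have hmono' : ∀ x y, Monotone fun n => f n x y := fun x y a b hab => hmono hab x y
  have hfin : ENNReal.ofReal dens * ∫⁻ x in A,
      expNeg (ENNReal.ofReal dens * ∫⁻ y, f 0 x y) ≠ ∞ := by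
    refine ENNReal.mul_ne_top ENNReal.ofReal_ne_top (ne_top_of_le_ne_top hAv ?_)
    calc _ ≤ ∫⁻ x in A, 1 := lintegral_mono fun x => expNeg_le_one _
      _ = volume A := by simp
  have hfin' : ∫⁻ x in A, expNeg (ENNReal.ofReal dens * ∫⁻ y, f 0 x y) ≠ ∞ := by
    refine ne_top_of_le_ne_top hAv ?_
    calc _ ≤ ∫⁻ x in A, 1 := lintegral_mono fun x => expNeg_le_one _
      _ = volume A := by simp
  have hmeas : ∀ n, Measurable fun x => ∫⁻ y, f n x y := fun n =>
    Measurable.lintegral_prod_right' (hfm n)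
  unfold HasMecke at h ⊢
  have e1 : ∀ m ω, prodExcept m (fun s => 1 - ⨆ n, f n (T m ω) (T s ω))
      = ⨅ n, prodExcept m (fun s => 1 - f n (T m ω) (T s ω)) := by
    intro m ω
    simp_rw [ENNReal.sub_iSup ENNReal.one_ne_top]
    exact prodExcept_iInf m (fun s a b hab => tsub_le_tsub_left (hmono' _ _ hab) 1)
      fun n s => tsub_le_self
  have e2 : ∀ x, expNeg (ENNReal.ofReal dens * ∫⁻ y, ⨆ n, f n x y)
      = ⨅ n, expNeg (ENNReal.ofReal dens * ∫⁻ y, f n x y) := by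
    intro x
    rw [lintegral_iSup (f := fun n y => f n x y) (fun n => (hfm n).comp measurable_prodMk_left)
      (fun a b hab y => hmono' x y hab), ENNReal.mul_iSup, expNeg_iSup]
  simp_rw [e1, e2]
  rw [lintegral_iInf (f := fun n x => expNeg (ENNReal.ofReal dens * ∫⁻ y, f n x y))
    (fun n => measurable_expNeg.comp ((hmeas n).const_mul _))
    (fun a b hab x => expNeg_antitone (by gcongr; exact hmono' x _ hab)) hfin']
  rw [tsum_lintegral_iInf (F := fun n m ω => prodExcept m (fun s => 1 - f n (T m ω) (T s ω)))
    (ν := fun m => μ.restrict (T m ⁻¹' A))]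
  · simp_rw [h]
    rw [ENNReal.mul_iInf' (fun h => absurd h ENNReal.ofReal_ne_top) fun _ => inferInstance]
  · exact fun n m => measurable_prodExcept m fun s =>
      measurable_const.sub ((hfm n).comp ((hT m).prodMk (hT s)))
  · exact fun m a b hab ω => iInf_mono fun k => Finset.prod_le_prod' fun s _ =>
      tsub_le_tsub_left (hmono' _ _ hab) 1
  · rw [h]; exact hfin

/-- Mecke's formula for a product functional that does not depend on the marked point. -/
theorem IsPoissonProcess.hasMecke_const (h : IsPoissonProcess μ dens T) (hd : 0 ≤ dens)
    {A : Set Plane} (hA : MeasurableSet A) (hAv : volume A ≠ ∞) {f : Plane → ℝ≥0∞}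
    (hf : Measurable f) (hf1 : ∀ x, f x ≤ 1) :
    HasMecke μ dens T A fun _ y => f y := by
  have hB : ∀ n : ℕ, MeasurableSet (Metric.ball (0 : Plane) n) := fun n =>
    Metric.isOpen_ball.measurableSet
  have hBmono : ∀ {a b : ℕ}, a ≤ b → Metric.ball (0 : Plane) a ⊆ Metric.ball 0 b :=
    fun hab => Metric.ball_subset_ball (by exact_mod_cast hab)
  -- Cutting off to balls gives the approximations supports of finite volume.
  let F : ℕ → SimpleFunc Plane ℝ≥0∞ := fun n =>
    (SimpleFunc.eapprox f n).restrict (Metric.ball 0 n)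
  have hF : ∀ n x, F n x = (Metric.ball (0 : Plane) n).indicator (SimpleFunc.eapprox f n) x :=
    fun n x => by simp only [F, SimpleFunc.restrict_apply _ (hB n)]
  have hle : ∀ n x, SimpleFunc.eapprox f n x ≤ f x := fun n x => by
    rw [← SimpleFunc.iSup_eapprox_apply hf x]; exact le_iSup (fun n => SimpleFunc.eapprox f n x) n
  have hFmono : Monotone fun n => (F n : Plane → ℝ≥0∞) := by
    intro a b hab x
    simp only [hF]
    refine (Set.indicator_le_indicator_of_subset (hBmono hab) (fun _ => zero_le) x).trans ?_
    exact Set.indicator_le_indicator (SimpleFunc.monotone_eapprox f hab x)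
  have hsup : (fun (_ : Plane) y => ⨆ n, F n y) = fun _ y => f y := by
    ext _ y
    apply le_antisymm
    · refine iSup_le fun n => ?_
      rw [hF]
      exact (Set.indicator_le_self _ _ y).trans (hle n y)
    · rw [← SimpleFunc.iSup_eapprox_apply hf y]
      refine iSup_le fun n => ?_
      obtain ⟨k, hk⟩ := exists_nat_gt (dist y 0)
      refine le_iSup_of_le (max n k) ?_
      rw [hF, Set.indicator_of_mem]
      · exact SimpleFunc.monotone_eapprox f (le_max_left n k) y
      · exact hBmono (le_max_right n k) hk
  rw [← hsup]
  refine HasMecke.iSup hAv h.measurable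
    (fun n => (F n).measurable.comp measurable_snd) (fun a b hab x => hFmono hab) fun n => ?_
  refine h.hasMecke_simpleFunc hd hA hAv (F n) (fun x => ?_) ?_
  · rw [hF]
    exact (Set.indicator_le_self _ _ x).trans ((hle n x).trans (hf1 x))
  · refine ne_top_of_le_ne_top (measure_ball_lt_top (x := (0 : Plane)) (r := n)).ne
      (measure_mono fun x hx => ?_)
    by_contra hx'
    exact hx (by rw [hF, Set.indicator_of_notMem hx'])

/-- Mecke's formula for a product functional that depends on a discretization of the marked
point. -/
theorem IsPoissonProcess.hasMecke_countable (h : IsPoissonProcess μ dens T) (hd : 0 ≤ dens)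
    {A : Set Plane} (hA : MeasurableSet A) (hAv : volume A ≠ ∞) {k : Plane → ℕ}
    (hk : Measurable k) {f : ℕ → Plane → ℝ≥0∞}
    (hf : ∀ i, Measurable (f i)) (hf1 : ∀ i x, f i x ≤ 1) :
    HasMecke μ dens T A fun x y => f (k x) y := by
  have hT := h.measurable
  have hm : ∀ i, MeasurableSet (A ∩ k ⁻¹' {i}) := fun i => hA.inter (hk (measurableSet_singleton i))
  have hU : A = ⋃ i, A ∩ k ⁻¹' {i} := by
    ext x; simp
  have hdis : Pairwise (Function.onFun Disjoint fun i => A ∩ k ⁻¹' {i}) := by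
    intro i j hij
    refine Set.disjoint_left.2 fun x hx hx' => hij ?_
    exact hx.2.symm.trans hx'.2
  -- On a cell where `k` is constant the functional no longer depends on the marked point; both
  -- sides are countably additive over cells.
  have key : ∀ i, HasMecke μ dens T (A ∩ k ⁻¹' {i}) fun x y => f (k x) y := by
    intro i
    have h0 := h.hasMecke_const hd (hm i) (ne_top_of_le_ne_top hAv (measure_mono Set.inter_subset_left))
      (hf i) (hf1 i)
    unfold HasMecke at h0 ⊢
    have e1 : ∀ m, ∫⁻ ω in T m ⁻¹' (A ∩ k ⁻¹' {i}),
          prodExcept m (fun s => 1 - f (k (T m ω)) (T s ω)) ∂μ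
        = ∫⁻ ω in T m ⁻¹' (A ∩ k ⁻¹' {i}), prodExcept m (fun s => 1 - f i (T s ω)) ∂μ := by
      intro m
      refine setLIntegral_congr_fun (hT m (hm i)) fun ω hω => ?_
      have : k (T m ω) = i := hω.2
      simp only [this]
    have e2 : ∫⁻ x in A ∩ k ⁻¹' {i}, expNeg (ENNReal.ofReal dens * ∫⁻ y, f (k x) y)
        = ∫⁻ x in A ∩ k ⁻¹' {i}, expNeg (ENNReal.ofReal dens * ∫⁻ y, f i y) := by
      refine setLIntegral_congr_fun (hm i) fun x hx => ?_
      have : k x = i := hx.2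
      simp only [this]
    simp_rw [e1, e2]
    exact h0
  unfold HasMecke at key ⊢
  have e1 : ∀ m (F : Ω → ℝ≥0∞), ∫⁻ ω in T m ⁻¹' A, F ω ∂μ
      = ∑' i, ∫⁻ ω in T m ⁻¹' (A ∩ k ⁻¹' {i}), F ω ∂μ := by
    intro m F
    conv_lhs => rw [hU, Set.preimage_iUnion]
    exact lintegral_iUnion (fun i => hT m (hm i))
      (fun i j hij => (hdis hij).preimage (T m)) _
  have e2 : ∀ F : Plane → ℝ≥0∞, ∫⁻ x in A, F x = ∑' i, ∫⁻ x in A ∩ k ⁻¹' {i}, F x := by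
    intro F
    conv_lhs => rw [hU]
    exact lintegral_iUnion hm hdis _
  simp_rw [e1]
  rw [e2, ENNReal.tsum_comm]
  simp_rw [key]
  rw [ENNReal.tsum_mul_left]

theorem exists_measurable_discretization {ε : ℝ} (hε : 0 < ε) :
    ∃ k : Plane → ℕ, Measurable k ∧ ∀ x, dist x (TopologicalSpace.denseSeq Plane (k x)) < ε := by
  classical
  have hex : ∀ x : Plane, ∃ k, dist x (TopologicalSpace.denseSeq Plane k) < ε := fun x => by
    obtain ⟨_, ⟨k, rfl⟩, hk⟩ :=
      Metric.mem_closure_iff.1 (TopologicalSpace.denseRange_denseSeq Plane x) ε hε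
    exact ⟨k, hk⟩
  refine ⟨fun x => Nat.find (hex x), measurable_find hex fun k => ?_, fun x => Nat.find_spec (hex x)⟩
  exact measurableSet_lt (measurable_id.dist measurable_const) measurable_const

/-- Infimum of `f` over the open ball of center `x` and radius `r`. -/
noncomputable def ballInf (f : Plane → ℝ≥0∞) (r : ℝ) (x : Plane) : ℝ≥0∞ :=
  ⨅ w ∈ Metric.ball x r, f w

theorem ballInf_le {f : Plane → ℝ≥0∞} {r : ℝ} {x w : Plane} (h : dist w x < r) :
    ballInf f r x ≤ f w :=
  iInf₂_le w h

theorem le_ballInf {f : Plane → ℝ≥0∞} {r : ℝ} {x : Plane} {c : ℝ≥0∞}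
    (h : ∀ w, dist w x < r → c ≤ f w) : c ≤ ballInf f r x :=
  le_iInf₂ fun w hw => h w hw

theorem ballInf_le_ballInf {f : Plane → ℝ≥0∞} {r r' : ℝ} {x x' : Plane}
    (h : r' + dist x' x ≤ r) : ballInf f r x ≤ ballInf f r' x' :=
  le_ballInf fun w hw => ballInf_le <| by linarith [dist_triangle w x' x]

/-- Strict sublevel sets are unions of open balls, whatever `f` is. -/
theorem measurable_ballInf (f : Plane → ℝ≥0∞) (r : ℝ) : Measurable (ballInf f r) := by
  refine measurable_of_Iio fun c => IsOpen.measurableSet ?_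
  have : ballInf f r ⁻¹' Set.Iio c = ⋃ w ∈ {w | f w < c}, {x | dist w x < r} := by
    ext y
    simp only [ballInf, Set.mem_preimage, Set.mem_Iio, iInf_lt_iff, Metric.mem_ball,
      Set.mem_iUnion, Set.mem_ofPred_eq, exists_prop]
    exact exists_congr fun w => and_comm
  rw [this]
  exact isOpen_biUnion fun w _ => isOpen_lt (by fun_prop) continuous_const

/-- A lower semicontinuous function is the supremum of its infima over balls of vanishing radius
that contain the point. -/
theorem iSup_ballInf {f : Plane → ℝ≥0∞} (hf : LowerSemicontinuous f) {r : ℕ → ℝ}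
    (hr : Tendsto r atTop (𝓝 0)) {x : Plane} {c : ℕ → Plane} (hc : ∀ n, dist x (c n) < r n) :
    ⨆ n, ballInf f (r n) (c n) = f x := by
  apply le_antisymm
  · exact iSup_le fun n => ballInf_le (hc n)
  · refine le_of_forall_lt fun b hb => ?_
    obtain ⟨b', hbb', hb'⟩ := exists_between hb
    obtain ⟨δ, hδ, hball⟩ := Metric.eventually_nhds_iff_ball.1 (hf x b' hb')
    obtain ⟨n, hn⟩ := (hr.eventually (gt_mem_nhds (half_pos hδ))).exists
    refine hbb'.trans_le (le_iSup_of_le n (le_ballInf fun w hw => (hball w ?_).le))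
    have h2 := dist_triangle w (c n) x
    rw [dist_comm (c n)] at h2
    rw [Metric.mem_ball]
    linarith [hc n]

/-- Mecke's formula for a translation invariant product functional. -/
theorem IsPoissonProcess.hasMecke_translation (h : IsPoissonProcess μ dens T) (hd : 0 ≤ dens)
    {A : Set Plane} (hA : MeasurableSet A) (hAv : volume A ≠ ∞) {f : Plane → ℝ≥0∞}
    (hf : LowerSemicontinuous f) (hf1 : ∀ x, f x ≤ 1) (v : Plane) :
    HasMecke μ dens T A fun x y => f (y - x - v) := by
  obtain ⟨ε, hε⟩ : ∃ ε : ℕ → ℝ, ε = fun n => (1 / 2) ^ n := ⟨_, rfl⟩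
  have hpos : ∀ n, 0 < ε n := fun n => by rw [hε]; positivity
  have hstep : ∀ n, 2 * ε (n + 1) = ε n := fun n => by simp only [hε]; ring
  have hlim : Tendsto (fun n => 3 * ε n) atTop (𝓝 0) := by
    rw [hε]
    simpa using (tendsto_pow_atTop_nhds_zero_of_lt_one (by norm_num : (0 : ℝ) ≤ 1 / 2)
      (by norm_num)).const_mul 3
  choose k hkm hk using fun n : ℕ => exists_measurable_discretization (hpos n)
  generalize TopologicalSpace.denseSeq Plane = D at hk
  -- The marked point is rounded to within `ε n`, and the infimum over a ball absorbs the error.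
  -- Radius `3 ε n` makes the approximations increase: consecutive centers differ by less than `ε n
  -- + ε (n + 1) = 3 ε (n + 1)`, and adding the next radius `3 ε (n + 1)` gives exactly `3 ε n`.
  obtain ⟨G, hG⟩ : ∃ G : ℕ → ℕ → Plane → ℝ≥0∞,
    ∀ n i, G n i = fun y => ballInf f (3 * ε n) (y - D i - v) := ⟨_, fun _ _ => rfl⟩
  have hGm : ∀ n i, Measurable (G n i) := fun n i => by
    rw [hG]
    exact (measurable_ballInf f _).comp ((measurable_id.sub_const _).sub_const _)
  have hG1 : ∀ n i y, G n i y ≤ 1 := fun n i y => by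
    rw [hG]
    exact (ballInf_le (w := y - D i - v) (by rw [dist_self]; linarith [hpos n])).trans (hf1 _)
  have hdist : ∀ n x y, dist (y - x - v) (y - D (k n x) - v) < ε n := by
    intro n x y
    have e : dist (y - x - v) (y - D (k n x) - v) = dist x (D (k n x)) := by
      simp [dist_eq_norm, norm_sub_rev]
    rw [e]; exact hk n x
  have hsup : (fun x y => ⨆ n, G n (k n x) y) = fun x y => f (y - x - v) := by
    ext x y
    simp_rw [hG]
    exact iSup_ballInf hf hlim fun n => by linarith [hdist n x y, hpos n]
  have hG_mono : ∀ n x y, G n (k n x) y ≤ G (n + 1) (k (n + 1) x) y := by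
    intro n x y
    simp_rw [hG]
    refine ballInf_le_ballInf ?_
    have h3 := dist_triangle (y - D (k (n + 1) x) - v) (y - x - v) (y - D (k n x) - v)
    rw [dist_comm (y - D (k (n + 1) x) - v) (y - x - v)] at h3
    linarith [hstep n, hdist n x y, hdist (n + 1) x y]
  rw [← hsup]
  refine HasMecke.iSup (f := fun n x y => G n (k n x) y) hAv h.measurable (fun n => ?_)
    (monotone_nat_of_le_succ hG_mono) fun n => h.hasMecke_countable hd hA hAv (hkm n) (hGm n) (hG1 n)
  have : Measurable (Function.uncurry (G n)) := measurable_from_prod_countable_right (hGm n)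
  exact this.comp (((hkm n).comp measurable_fst).prodMk measurable_snd)

theorem IsPoissonProcess.tsum_lintegral_translation (h : IsPoissonProcess μ dens T) (hd : 0 ≤ dens)
    {A : Set Plane} (hA : MeasurableSet A) (hAv : volume A ≠ ∞) {f : Plane → ℝ≥0∞}
    (hf : LowerSemicontinuous f) (hf1 : ∀ x, f x ≤ 1) (v : Plane) :
    ∑' m, ∫⁻ ω in T m ⁻¹' A, prodExcept m (fun s => 1 - f (T s ω - T m ω - v)) ∂μ
      = ENNReal.ofReal dens * volume A * expNeg (ENNReal.ofReal dens * ∫⁻ y, f y) := by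
  have := h.hasMecke_translation hd hA hAv hf hf1 v
  unfold HasMecke at this
  rw [this]
  have e : ∀ x : Plane, ∫⁻ y, f (y - x - v) = ∫⁻ y, f y := fun x => by
    simp_rw [sub_sub]
    exact lintegral_sub_right_eq_self f (x + v)
  simp_rw [e]
  rw [setLIntegral_const]
  ring

end EnergyHarvesting

namespace EnergyHarvesting

/-! ### Rayleigh fading -/

theorem lintegral_Ioi_mul_exp_neg_mul_sq {k a : ℝ} (hk : 0 < k) (ha : 0 ≤ a) :
    ∫⁻ x in Set.Ioi a, ENNReal.ofReal (2 * k * x * Real.exp (-(k * x ^ 2)))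
      = ENNReal.ofReal (Real.exp (-(k * a ^ 2))) := by
  have hderiv : ∀ x ∈ Set.Ici a, HasDerivAt (fun x => -Real.exp (-(k * x ^ 2)))
      (2 * k * x * Real.exp (-(k * x ^ 2))) x := by
    intro x _
    have h1 : HasDerivAt (fun x : ℝ => -(k * x ^ 2)) (-(k * (2 * x))) x := by
      simpa using! (((hasDerivAt_id x).pow 2).const_mul k).neg
    have h2 := h1.exp.neg
    have e : -(Real.exp (-(k * x ^ 2)) * -(k * (2 * x)))
        = 2 * k * x * Real.exp (-(k * x ^ 2)) := by ring
    rwa [e] at h2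
  have hpos : ∀ x ∈ Set.Ioi a, 0 ≤ 2 * k * x * Real.exp (-(k * x ^ 2)) := by
    intro x hx
    have : 0 ≤ x := ha.trans (le_of_lt hx)
    positivity
  have hlim : Tendsto (fun x : ℝ => -Real.exp (-(k * x ^ 2))) atTop (𝓝 (-0)) := by
    refine (Real.tendsto_exp_neg_atTop_nhds_zero.comp ?_).neg
    exact (tendsto_pow_atTop two_ne_zero).const_mul_atTop hk
  have hint := integrableOn_Ioi_deriv_of_nonneg' hderiv hpos hlim
  rw [← ofReal_integral_eq_lintegral_ofReal hint
    ((ae_restrict_iff' measurableSet_Ioi).2 (ae_of_all _ hpos)),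
    integral_Ioi_of_hasDerivAt_of_nonneg' hderiv hpos hlim]
  simp

theorem lintegral_rayleighMeasure {σ : ℝ} {F : ℝ → ℝ≥0∞} (hF : Measurable F) :
    ∫⁻ x, F x ∂(rayleighMeasure σ)
      = ∫⁻ x in Set.Ioi 0, F x * ENNReal.ofReal (x / σ ^ 2 * Real.exp (-x ^ 2 / (2 * σ ^ 2))) := by
  have hm : Measurable fun x : ℝ =>
      ENNReal.ofReal (if 0 ≤ x then x / σ ^ 2 * Real.exp (-x ^ 2 / (2 * σ ^ 2)) else 0) :=
    (Measurable.ite measurableSet_Ici (by fun_prop) measurable_const).ennreal_ofReal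
  rw [rayleighMeasure, lintegral_withDensity_eq_lintegral_mul _ hm hF,
    ← lintegral_indicator measurableSet_Ioi]
  refine lintegral_congr fun x => ?_
  simp only [Pi.mul_apply]
  rcases lt_trichotomy x 0 with hx | rfl | hx
  · rw [if_neg hx.not_ge, Set.indicator_of_notMem (by simpa using hx.le)]; simp
  · simp
  · rw [if_pos hx.le, Set.indicator_of_mem (Set.mem_Ioi.2 hx), mul_comm]

/-- For `X` of this law `X ^ 2 / (2 σ ^ 2)` is standard exponential, with Laplace transform `1 / (1
+ y)`. -/
theorem lintegral_expNeg_rayleighMeasure {σ y : ℝ} (hσ : 0 < σ) (hy : 0 ≤ y) :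
    ∫⁻ x, expNeg (ENNReal.ofReal (y / (2 * σ ^ 2) * x ^ 2)) ∂(rayleighMeasure σ)
      = ENNReal.ofReal (1 / (1 + y)) := by
  rw [lintegral_rayleighMeasure (F := fun x => expNeg (ENNReal.ofReal (y / (2 * σ ^ 2) * x ^ 2)))
    (measurable_expNeg.comp (by fun_prop))]
  have hk : 0 < (1 + y) / (2 * σ ^ 2) := by positivity
  have h := lintegral_Ioi_mul_exp_neg_mul_sq hk le_rfl
  have e : ∀ x ∈ Set.Ioi (0 : ℝ), expNeg (ENNReal.ofReal (y / (2 * σ ^ 2) * x ^ 2))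
      * ENNReal.ofReal (x / σ ^ 2 * Real.exp (-x ^ 2 / (2 * σ ^ 2)))
      = ENNReal.ofReal (1 / (1 + y)) * ENNReal.ofReal (2 * ((1 + y) / (2 * σ ^ 2)) * x
        * Real.exp (-((1 + y) / (2 * σ ^ 2) * x ^ 2))) := by
    intro x hx
    rw [expNeg_ofReal (by positivity), ← ENNReal.ofReal_mul (Real.exp_nonneg _),
      ← ENNReal.ofReal_mul (by positivity)]
    congr 1
    have : -((1 + y) / (2 * σ ^ 2) * x ^ 2)
        = -(y / (2 * σ ^ 2) * x ^ 2) + -x ^ 2 / (2 * σ ^ 2) := by field_simp; ring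
    rw [this, Real.exp_add]
    field_simp
  rw [setLIntegral_congr_fun measurableSet_Ioi e, lintegral_const_mul _ (by fun_prop), h]
  simp

/-- Exponential tail of the squared amplitude. The conventions for division agree with it at the
ends: `i = 0` gives `1` and `i = ∞` gives `0`. -/
theorem rayleighMeasure_lt_div {σ b θ : ℝ} (hσ : 0 < σ) (hb : 0 < b) (hθ : 0 < θ) (i : ℝ≥0∞) :
    rayleighMeasure σ {x | ENNReal.ofReal θ < ENNReal.ofReal (b * x ^ 2) / i}
      = expNeg (ENNReal.ofReal (θ / (2 * σ ^ 2 * b)) * i) := by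
  rcases eq_or_ne i ∞ with rfl | hi
  · have : ENNReal.ofReal (θ / (2 * σ ^ 2 * b)) ≠ 0 := by
      simp only [ne_eq, ENNReal.ofReal_eq_zero, not_le]; positivity
    simp [ENNReal.mul_top this]
  obtain ⟨r, hr, rfl⟩ : ∃ r : ℝ, 0 ≤ r ∧ i = ENNReal.ofReal r :=
    ⟨i.toReal, ENNReal.toReal_nonneg, (ENNReal.ofReal_toReal hi).symm⟩
  set s := √(θ * r / b) with hs
  have hs2 : s ^ 2 = θ * r / b := Real.sq_sqrt (by positivity)
  have hs0 : 0 ≤ s := Real.sqrt_nonneg _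
  have hset : ∀ x : ℝ, ENNReal.ofReal θ < ENNReal.ofReal (b * x ^ 2) / ENNReal.ofReal r
      ↔ s < |x| := by
    intro x
    rw [ENNReal.lt_div_iff_mul_lt (.inr ENNReal.ofReal_ne_top) (.inr (by simpa using hθ)),
      ← ENNReal.ofReal_mul hθ.le, ENNReal.ofReal_lt_ofReal_iff_of_nonneg (by positivity),
      hs, ← Real.sqrt_sq_eq_abs, Real.sqrt_lt_sqrt_iff (by positivity), div_lt_iff₀ hb, mul_comm b]
  have hm : MeasurableSet {x : ℝ | s < |x|} := measurableSet_lt measurable_const measurable_id.abs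
  have hk : 0 < 1 / (2 * σ ^ 2) := by positivity
  simp_rw [hset]
  rw [← lintegral_indicator_one hm, lintegral_rayleighMeasure (measurable_one.indicator hm)]
  have e : ∀ x ∈ Set.Ioi (0 : ℝ), Set.indicator {x : ℝ | s < |x|} 1 x
        * ENNReal.ofReal (x / σ ^ 2 * Real.exp (-x ^ 2 / (2 * σ ^ 2)))
      = Set.indicator (Set.Ioi s) (fun x => ENNReal.ofReal (2 * (1 / (2 * σ ^ 2)) * x
        * Real.exp (-(1 / (2 * σ ^ 2) * x ^ 2)))) x := by
    intro x (hx : 0 < x)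
    by_cases hsx : s < x
    · rw [Set.indicator_of_mem (show x ∈ {x : ℝ | s < |x|} by simpa [abs_of_pos hx] using hsx),
        Set.indicator_of_mem (Set.mem_Ioi.2 hsx), Pi.one_apply, one_mul]
      congr 2
      · field_simp
      · congr 1; field_simp
    · rw [Set.indicator_of_notMem (show x ∉ {x : ℝ | s < |x|} by simpa [abs_of_pos hx] using hsx),
        Set.indicator_of_notMem (show x ∉ Set.Ioi s from hsx), zero_mul]
  rw [setLIntegral_congr_fun measurableSet_Ioi e, setLIntegral_indicator measurableSet_Ioi,
    Set.inter_eq_left.2 (Set.Ioi_subset_Ioi hs0), lintegral_Ioi_mul_exp_neg_mul_sq hk hs0,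
    ← ENNReal.ofReal_mul (by positivity), expNeg_ofReal (by positivity), hs2]
  congr 3
  field_simp

/-! ### The interference integral -/

/-- Write `1 / (c + r ^ α)` as the integral of `exp (-w (c + r ^ α))` over `w > 0` and swap. The
integrals over `r` and then `w` produce `Γ (2 / α)` and `Γ (1 - 2 / α)`, the latter convergent
because `α > 2`; the reflection formula gives the sine. -/
theorem lintegral_Ioi_mul_div_add_rpow {α c : ℝ} (hα : 2 < α) (hc : 0 < c) :
    ∫⁻ r in Set.Ioi (0 : ℝ), ENNReal.ofReal (r * (c / (c + r ^ α)))
      = ENNReal.ofReal (c ^ (2 / α) * (Real.pi / (α * Real.sin (2 * Real.pi / α)))) := by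
  have hα0 : 0 < α := by linarith
  have h2α : 2 / α < 1 := by rw [div_lt_one hα0]; exact hα
  have h2α0 : 0 < 2 / α := by positivity
  have hexp : ∀ b : ℝ, 0 < b →
      ∫⁻ w in Set.Ioi (0 : ℝ), ENNReal.ofReal (Real.exp (-(w * b))) = ENNReal.ofReal (1 / b) := by
    intro b hb
    have hi : IntegrableOn (fun w : ℝ => Real.exp (-b * w)) (Set.Ioi 0) :=
      integrableOn_exp_mul_Ioi (by linarith) 0
    have := ofReal_integral_eq_lintegral_ofReal hi (ae_of_all _ fun w => (Real.exp_nonneg _))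
    rw [integral_exp_mul_Ioi (by linarith) 0] at this
    have e : ∀ w : ℝ, -(w * b) = -b * w := fun w => by ring
    simp_rw [e]
    rw [← this]
    congr 1
    simp
  have hr : ∀ w ∈ Set.Ioi (0 : ℝ), ∫⁻ r in Set.Ioi (0 : ℝ),
      ENNReal.ofReal (r * c * Real.exp (-(w * (c + r ^ α))))
      = ENNReal.ofReal (c * (1 / α) * Real.Gamma (2 / α))
        * ENNReal.ofReal (w ^ ((1 - 2 / α) - 1) * Real.exp (-(c * w))) := by
    intro w (hw : 0 < w)
    have hi := integrableOn_rpow_mul_exp_neg_mul_rpow (s := 1) (by norm_num) hα0 hw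
    have hi' := hi.const_mul (c * Real.exp (-(c * w)))
    have e : ∀ r ∈ Set.Ioi (0 : ℝ), ENNReal.ofReal (r * c * Real.exp (-(w * (c + r ^ α))))
        = ENNReal.ofReal (c * Real.exp (-(c * w)) * (r ^ (1 : ℝ) * Real.exp (-w * r ^ α))) := by
      intro r _
      rw [Real.rpow_one]
      have : -(w * (c + r ^ α)) = -(c * w) + -w * r ^ α := by ring
      rw [this, Real.exp_add]
      ring_nf
    rw [setLIntegral_congr_fun measurableSet_Ioi e, ← ofReal_integral_eq_lintegral_ofReal hi'
      ((ae_restrict_iff' measurableSet_Ioi).2 (ae_of_all _ fun r (hr : 0 < r) => by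
        simp only [Pi.zero_apply]; positivity)),
      integral_const_mul, integral_rpow_mul_exp_neg_mul_rpow hα0 (by norm_num) hw,
      ← ENNReal.ofReal_mul]
    · congr 1
      have e1 : -((1 : ℝ) + 1) / α = 1 - 2 / α - 1 := by ring
      have e2 : ((1 : ℝ) + 1) / α = 2 / α := by norm_num
      rw [e1, e2]
      ring
    · have := Real.Gamma_nonneg_of_nonneg h2α0.le
      positivity
  have hG : ∫⁻ w in Set.Ioi (0 : ℝ), ENNReal.ofReal (w ^ ((1 - 2 / α) - 1) * Real.exp (-(c * w)))
      = ENNReal.ofReal ((1 / c) ^ (1 - 2 / α) * Real.Gamma (1 - 2 / α)) := by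
    have hi := integrableOn_rpow_mul_exp_neg_mul_rpow (s := (1 - 2 / α) - 1) (by linarith)
      one_pos hc
    simp only [Real.rpow_one, neg_mul] at hi
    rw [← ofReal_integral_eq_lintegral_ofReal hi
      ((ae_restrict_iff' measurableSet_Ioi).2 (ae_of_all _ fun r (hr : 0 < r) => by
        simp only [Pi.zero_apply]; positivity)),
      Real.integral_rpow_mul_exp_neg_mul_Ioi (by linarith) hc]
  have hstart : ∀ r ∈ Set.Ioi (0 : ℝ), ENNReal.ofReal (r * (c / (c + r ^ α)))
      = ∫⁻ w in Set.Ioi (0 : ℝ), ENNReal.ofReal (r * c * Real.exp (-(w * (c + r ^ α)))) := by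
    intro r (hr : 0 < r)
    have : 0 < c + r ^ α := by positivity
    simp_rw [ENNReal.ofReal_mul (show 0 ≤ r * c by positivity)]
    rw [lintegral_const_mul _ (by fun_prop), hexp _ this, ← ENNReal.ofReal_mul (by positivity)]
    congr 1
    ring
  rw [setLIntegral_congr_fun measurableSet_Ioi hstart, lintegral_lintegral_swap,
    setLIntegral_congr_fun measurableSet_Ioi hr, lintegral_const_mul _ (by fun_prop), hG,
    ← ENNReal.ofReal_mul]
  · congr 1
    have h1 := Real.Gamma_mul_Gamma_one_sub (2 / α)
    have h3 : Real.pi * (2 / α) = 2 * Real.pi / α := by ring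
    rw [h3] at h1
    have h2 : c * (1 / c) ^ (1 - 2 / α) = c ^ (2 / α) := by
      rw [one_div, Real.inv_rpow hc.le, ← Real.rpow_neg hc.le]
      nth_rewrite 1 [← Real.rpow_one c]
      rw [← Real.rpow_add hc]
      congr 1; ring
    calc c * (1 / α) * Real.Gamma (2 / α) * ((1 / c) ^ (1 - 2 / α) * Real.Gamma (1 - 2 / α))
        = (c * (1 / c) ^ (1 - 2 / α)) * (1 / α) * (Real.Gamma (2 / α) * Real.Gamma (1 - 2 / α)) := by
          ring
      _ = _ := by
          rw [h1, h2, mul_assoc, div_mul_div_comm, one_mul]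
  · have := Real.Gamma_nonneg_of_nonneg h2α0.le
    positivity
  · exact (by fun_prop : Measurable _).aemeasurable

theorem kappa_pos {α : ℝ} (hα : 2 < α) : 0 < kappa α := by
  have hα0 : 0 < α := by linarith
  have : 0 < Real.sin (2 * Real.pi / α) := by
    refine Real.sin_pos_of_pos_of_lt_pi (by positivity) ?_
    rw [div_lt_iff₀ hα0]
    nlinarith [Real.pi_pos]
  unfold kappa
  positivity

/-- The loss `a y / (1 + y)` of success probability, where `y = c r ^ (-α)`, caused by a
transmitter at distance `r` that is active with probability `a`. -/
noncomputable def interferenceLoss (a c α r : ℝ) : ℝ :=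
  a * (c * r ^ (-α) / (1 + c * r ^ (-α)))

theorem interferenceLoss_of_pos {a c α r : ℝ} (hr : 0 < r) :
    interferenceLoss a c α r = a * (c / (c + r ^ α)) := by
  have h : 0 < r ^ α := Real.rpow_pos_of_pos hr α
  rw [interferenceLoss, Real.rpow_neg hr.le]
  congr 1
  field_simp
  ring

theorem lintegral_interferenceLoss {a c α : ℝ} (ha : 0 ≤ a) (hc : 0 < c) (hα : 2 < α) :
    ∫⁻ z : Plane, ENNReal.ofReal (interferenceLoss a c α ‖z‖)
      = ENNReal.ofReal (a * c ^ (2 / α) * kappa α) := by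
  have hα0 : 0 < α := by linarith
  have hm : Measurable (interferenceLoss a c α) := by unfold interferenceLoss; fun_prop
  have hpos : ∀ r : ℝ, 0 < r → 0 ≤ interferenceLoss a c α r := fun r hr => by
    rw [interferenceLoss_of_pos hr]; positivity
  have hnn : ∀ z : Plane, 0 ≤ interferenceLoss a c α ‖z‖ := fun z => by
    unfold interferenceLoss; positivity
  have hL : ∫⁻ r in Set.Ioi (0 : ℝ), ENNReal.ofReal (r * interferenceLoss a c α r)
      = ENNReal.ofReal (a * (c ^ (2 / α) * (Real.pi / (α * Real.sin (2 * Real.pi / α))))) := by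
    rw [ENNReal.ofReal_mul ha, ← lintegral_Ioi_mul_div_add_rpow hα hc,
      ← lintegral_const_mul _ (by fun_prop)]
    refine setLIntegral_congr_fun measurableSet_Ioi fun r (hr : 0 < r) => ?_
    rw [interferenceLoss_of_pos hr, ← ENNReal.ofReal_mul ha]
    congr 1; ring
  have hnn1 : 0 ≤ᵐ[volume.restrict (Set.Ioi (0 : ℝ))] fun r => r * interferenceLoss a c α r :=
    (ae_restrict_iff' measurableSet_Ioi).2 (ae_of_all _ fun r (hr : 0 < r) =>
      mul_nonneg hr.le (hpos r hr))
  have hm' : Measurable fun r => r * interferenceLoss a c α r := measurable_id.mul hm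
  have hint : IntegrableOn (fun r => r * interferenceLoss a c α r) (Set.Ioi 0) := by
    refine (lintegral_ofReal_ne_top_iff_integrable hm'.aestronglyMeasurable hnn1).1 ?_
    rw [hL]; exact ENNReal.ofReal_ne_top
  have hval : ∫ r in Set.Ioi (0 : ℝ), r * interferenceLoss a c α r
      = a * (c ^ (2 / α) * (Real.pi / (α * Real.sin (2 * Real.pi / α)))) := by
    rw [integral_eq_lintegral_of_nonneg_ae hnn1 hm'.aestronglyMeasurable, hL,
      ENNReal.toReal_ofReal]
    have := kappa_pos hα
    have e : Real.pi / (α * Real.sin (2 * Real.pi / α)) = kappa α / (2 * Real.pi) := by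
      unfold kappa; field_simp
    rw [e]; positivity
  -- Integrability is needed because the polar coordinate formula is applied to Bochner integrals.
  have hint2 : Integrable (fun z : Plane => interferenceLoss a c α ‖z‖) := by
    rw [integrable_fun_norm_addHaar (volume : Measure Plane)]
    simpa using hint
  rw [← ofReal_integral_eq_lintegral_ofReal hint2 (ae_of_all _ hnn),
    integral_fun_norm_addHaar (volume : Measure Plane)]
  congr 1
  have hvol : (volume : Measure Plane).real (Metric.ball 0 1) = Real.pi := by
    rw [measureReal_def, EuclideanSpace.volume_ball_fin_two]
    simp [Real.pi_nonneg]
  rw [hvol]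
  simp only [finrank_euclideanSpace, Fintype.card_fin, smul_eq_mul, nsmul_eq_mul]
  norm_num
  rw [hval]
  unfold kappa
  ring

/-- Since `0 ^ (-α) = 0`, the loss takes the value `0` at the origin instead of its limit `a`. Lower
semicontinuity survives this and is all that the approximation by `ballInf` requires. -/
theorem lowerSemicontinuous_interferenceLoss {a c α : ℝ} (hc : 0 < c) (hα : 0 < α) :
    LowerSemicontinuous fun z : Plane => ENNReal.ofReal (interferenceLoss a c α ‖z‖) := by
  intro z
  rcases eq_or_ne z 0 with rfl | hz
  · intro b hb
    simp [interferenceLoss, Real.zero_rpow (neg_ne_zero.2 hα.ne')] at hb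
  · refine ContinuousAt.lowerSemicontinuousAt ?_
    refine ENNReal.continuous_ofReal.continuousAt.comp (f := fun z : Plane =>
      interferenceLoss a c α ‖z‖) ?_
    have h0 : ‖z‖ ≠ 0 := norm_ne_zero_iff.2 hz
    have h1 : ContinuousAt (fun z : Plane => ‖z‖ ^ (-α)) z :=
      continuous_norm.continuousAt.rpow_const (.inl h0)
    have h2 : 1 + c * ‖z‖ ^ (-α) ≠ 0 := by positivity
    unfold interferenceLoss
    exact continuousAt_const.mul ((continuousAt_const.mul h1).div
      (continuousAt_const.add (continuousAt_const.mul h1)) h2)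

end EnergyHarvesting

/-! ### Averaging the interference over fading and activity -/

namespace EnergyHarvesting

theorem lintegral_prodExcept {Ω : Type*} [MeasurableSpace Ω] {ν : Measure Ω} [IsFiniteMeasure ν]
    (m : ℕ) {g : Ω → ℕ → ℝ≥0∞} (hg : ∀ s, Measurable fun ω => g ω s) (hg1 : ∀ ω s, g ω s ≤ 1) :
    ∫⁻ ω, prodExcept m (g ω) ∂ν
      = ⨅ n, ∫⁻ ω, ∏ s ∈ (Finset.range n).erase m, g ω s ∂ν := by
  refine lintegral_iInf (f := fun n ω => ∏ s ∈ (Finset.range n).erase m, g ω s)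
    (fun n => Finset.measurable_prod _ fun s _ => hg s) (fun a b hab ω => ?_) ?_
  · exact Finset.prod_le_prod_of_subset_of_le_one'
      (Finset.erase_subset_erase m (Finset.range_subset_range.2 hab)) fun s _ _ => hg1 ω s
  · simp

namespace Network

variable {Ω : Type*}

/-- Fading amplitude of transmitter `s` at the receiver of `m`, set to `0` if `s` is silent. -/
noncomputable def amplitude (N : Network Ω) (m t s : ℕ) (ω : Ω) : ℝ :=
  {ω | N.Active s t ω}.indicator (fun ω => ‖N.fade m s ω‖) ω

/-- Power received by the receiver of `m` from transmitter `s`, which is `0` if `s` is silent. -/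
noncomputable def activePower (N : Network Ω) (d α : ℝ) (m t s : ℕ) (ω : Ω) : ℝ≥0∞ :=
  ENNReal.ofReal (dist (N.loc s ω) (N.receiver d m ω) ^ (-α) * N.amplitude m t s ω ^ 2)

theorem interference_eq_tsum (N : Network Ω) (d α : ℝ) (m t : ℕ) (ω : Ω) :
    N.interference d α m t ω = ∑' s, if s = m then 0 else
      N.activePower d α m t s ω := by
  refine tsum_congr fun s => ?_
  by_cases hs : s = m
  · simp [hs]
  unfold activePower
  by_cases ha : N.Active s t ω
  · rw [if_neg hs, Set.indicator_of_mem (show s ∈ {s | s ≠ m ∧ N.Active s t ω} from ⟨hs, ha⟩),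
      amplitude, Set.indicator_of_mem (show ω ∈ {ω | N.Active s t ω} from ha), rxPower]
  · rw [if_neg hs, Set.indicator_of_notMem (fun h => ha h.2), amplitude,
      Set.indicator_of_notMem (show ω ∉ {ω | N.Active s t ω} from ha)]
    simp

/-- The sources that determine `amplitude m t s`. -/
def amplitudeSources (m t s : ℕ) : Set Source := insert (.fade m s) (activeSources s t)

/-- The sources that determine the interference of the transmitters of `F` at the receiver
of `m`. -/
def interferenceSources (m t : ℕ) (F : Set ℕ) : Set Source :=
  {.loc, .dir m} ∪ ⋃ s ∈ F, amplitudeSources m t s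

theorem measurable_amplitude_sigma (N : Network Ω) (m t s : ℕ) {S : Set Source}
    (hS : amplitudeSources m t s ⊆ S) : Measurable[N.sigma S] (N.amplitude m t s) := by
  have h1 : Measurable[N.sigma S] (N.fade m s) :=
    N.measurable_fade_sigma (hS (Set.mem_insert _ _))
  have h2 : MeasurableSet[N.sigma S] {ω | N.Active s t ω} :=
    N.sigma_mono ((Set.subset_insert _ _).trans hS) _ (N.measurableSet_active_sigma s t)
  exact Measurable.indicator (measurable_norm.comp h1) h2

theorem measurable_receiver_sigma (N : Network Ω) (d : ℝ) (m : ℕ) {S : Set Source}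
    (hl : Source.loc ∈ S) (hd : Source.dir m ∈ S) : Measurable[N.sigma S] (N.receiver d m) := by
  have h1 := N.measurable_loc_sigma hl m
  have h2 := N.measurable_dir_sigma hd
  have h3 : Measurable fun x : Plane × Plane => x.1 + d • x.2 := by fun_prop
  exact h3.comp (h1.prodMk h2)

theorem measurable_dist_receiver_sigma (N : Network Ω) (d : ℝ) (m s : ℕ) {S : Set Source}
    (hl : Source.loc ∈ S) (hd : Source.dir m ∈ S) :
    Measurable[N.sigma S] fun ω => dist (N.loc s ω) (N.receiver d m ω) :=
  (measurable_fst.dist measurable_snd).comp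
    ((N.measurable_loc_sigma hl s).prodMk (N.measurable_receiver_sigma d m hl hd))

theorem measurable_rx (α : ℝ) : Measurable fun x : ℝ × ℝ =>
    ENNReal.ofReal (x.1 ^ (-α) * x.2 ^ 2) := by fun_prop

theorem measurable_activePower_sigma (N : Network Ω) (d α : ℝ) {m t s : ℕ} {F : Set ℕ}
    (hs : s ∈ F) {S : Set Source} (hS : interferenceSources m t F ⊆ S) :
    Measurable[N.sigma S] (N.activePower d α m t s) := by
  have h1 := N.measurable_dist_receiver_sigma d m s (hS (.inl (by simp))) (hS (.inl (by simp)))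
  have h2 := N.measurable_amplitude_sigma m t s (S := S)
    ((Set.subset_biUnion_of_mem (u := amplitudeSources m t) hs).trans
      (Set.subset_union_right.trans hS))
  exact (measurable_rx α).comp (h1.prodMk h2)

theorem measurable_interference_sigma (N : Network Ω) (d α : ℝ) (m t : ℕ) :
    Measurable[N.sigma (interferenceSources m t {s | s ≠ m})] (N.interference d α m t) := by
  rw [funext (N.interference_eq_tsum d α m t)]
  let _ : MeasurableSpace Ω := N.sigma (interferenceSources m t {s | s ≠ m})
  refine Measurable.tsum fun s => ?_
  by_cases hs : s = m
  · simp only [hs, if_true]; exact measurable_const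
  · simp only [hs, if_false]
    exact N.measurable_activePower_sigma d α (F := {s | s ≠ m}) hs subset_rfl

theorem fade_notMem_amplitudeSources {m t s : ℕ} (hs : s ≠ m) :
    Source.fade m m ∉ amplitudeSources m t s := by
  rintro (h | h | ⟨_, _, h | h⟩)
  · injection h with _ h; exact hs h.symm
  all_goals exact Source.noConfusion h

theorem disjoint_interferenceSources_fade (m t : ℕ) :
    Disjoint (interferenceSources m t {s | s ≠ m}) {.fade m m} := by
  rw [Set.disjoint_singleton_right]
  rintro (h | h)
  · simp at h
  · simp only [Set.mem_iUnion] at h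
    obtain ⟨s, hs, h⟩ := h
    exact fade_notMem_amplitudeSources hs h

theorem disjoint_amplitudeSources {m t s s' : ℕ} (h : s ≠ s') :
    Disjoint (amplitudeSources m t s) (amplitudeSources m t s') := by
  rw [Set.disjoint_left]
  rintro i (rfl | rfl | ⟨u, _, rfl | rfl⟩) <;>
    rintro (h' | h' | ⟨u, _, h' | h'⟩) <;> (simp at h' <;> omega)

theorem disjoint_interferenceSources_amplitude {m t s : ℕ} {F : Set ℕ} (hs : s ∉ F) :
    Disjoint (interferenceSources m t F) (amplitudeSources m t s) := by
  refine Set.disjoint_union_left.2 ⟨?_, ?_⟩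
  · rw [Set.disjoint_left]
    rintro i (rfl | rfl) (h' | h' | ⟨u, _, h' | h'⟩) <;> simp at h'
  · refine Set.disjoint_iUnion₂_left.2 fun s' hs' => disjoint_amplitudeSources ?_
    rintro rfl; exact hs hs'

theorem disjoint_fade_active (m t s : ℕ) :
    Disjoint (activeSources s t) {.fade m s} := by
  rw [Set.disjoint_singleton_right]
  rintro (h | ⟨u, _, h | h⟩) <;> simp at h

variable [MeasurableSpace Ω] {N : Network Ω} {μ : Measure Ω} [IsProbabilityMeasure μ]
  {dens p q : ℝ}

omit [IsProbabilityMeasure μ] in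
theorem IsAloha.lintegral_fade (h : N.IsAloha μ dens p q) {σ : ℝ}
    (hσ : ∀ m s, HasLaw (fun ω => ‖N.fade m s ω‖) (rayleighMeasure σ) μ) (m s : ℕ)
    {F : ℝ → ℝ≥0∞} (hF : Measurable F) :
    ∫⁻ ω, F ‖N.fade m s ω‖ ∂μ = ∫⁻ x, F x ∂(rayleighMeasure σ) := by
  rw [← (hσ m s).map_eq, lintegral_map hF
    (show Measurable fun ω => ‖N.fade m s ω‖ from measurable_norm.comp (h.measurable_fade m s))]

/-- With probability `a` the interferer is active and contributes `1 / (1 + y)`, otherwise `1`; the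
mixture is `1 - a y / (1 + y)`. -/
theorem IsAloha.lintegral_expNeg_amplitude (h : N.IsAloha μ dens p q) (hp : 0 ≤ p) (hp1 : p ≤ 1)
    (hq : 0 ≤ q) (hq1 : q ≤ 1) {σ : ℝ} (hσ0 : 0 < σ)
    (hσ : ∀ m s, HasLaw (fun ω => ‖N.fade m s ω‖) (rayleighMeasure σ) μ) (m t s : ℕ)
    {y : ℝ} (hy : 0 ≤ y) :
    ∫⁻ ω, expNeg (ENNReal.ofReal (y / (2 * σ ^ 2) * N.amplitude m t s ω ^ 2)) ∂μ
      = 1 - ENNReal.ofReal (N.energyProb μ 0 t * q * (y / (1 + y))) := by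
  classical
  have ha0 : 0 ≤ N.energyProb μ 0 t := measureReal_nonneg
  have ha1 : N.energyProb μ 0 t ≤ 1 := measureReal_le_one
  set a := N.energyProb μ 0 t * q with ha
  have haq0 : 0 ≤ a := mul_nonneg ha0 hq
  have haq1 : a ≤ 1 := mul_le_one₀ ha1 hq hq1
  let A : Ω → Bool := fun ω => decide (N.Active s t ω)
  have hA : Measurable[N.sigma (activeSources s t)] A := by
    refine measurable_to_bool ?_
    have : A ⁻¹' {true} = {ω | N.Active s t ω} := by ext; simp [A]
    rw [this]
    exact N.measurableSet_active_sigma s t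
  have hA' : Measurable A := hA.mono (h.sigma_le _) le_rfl
  have hAp : μ {ω | A ω = true} = ENNReal.ofReal a := by
    rw [← h.measure_active hp hp1 hq hq1 s t]
    simp [A]
  let G : Bool → ℂ → ℝ≥0∞ := fun b z =>
    if b = true then expNeg (ENNReal.ofReal (y / (2 * σ ^ 2) * ‖z‖ ^ 2)) else 1
  have hGm : Measurable (Function.uncurry G) := by
    refine measurable_from_prod_countable_right fun b => ?_
    cases b
    · exact measurable_const
    · exact measurable_expNeg.comp (by fun_prop)
  have e1 : ∀ ω, expNeg (ENNReal.ofReal (y / (2 * σ ^ 2) * N.amplitude m t s ω ^ 2))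
      = G (A ω) (N.fade m s ω) := by
    intro ω
    by_cases hω : N.Active s t ω <;> simp [G, A, amplitude, hω]
  simp_rw [e1]
  rw [h.lintegral_comp (disjoint_fade_active m t s) hA
    (N.measurable_fade_sigma (Set.mem_singleton _)) hGm,
    lintegral_bool hA' haq0 hAp fun b => ∫⁻ ω', G b (N.fade m s ω') ∂μ]
  have e2 : ∫⁻ ω', G true (N.fade m s ω') ∂μ = ENNReal.ofReal (1 / (1 + y)) := by
    rw [← lintegral_expNeg_rayleighMeasure hσ0 hy]
    exact h.lintegral_fade hσ m s
      (F := fun x => expNeg (ENNReal.ofReal (y / (2 * σ ^ 2) * x ^ 2)))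
      (measurable_expNeg.comp (by fun_prop))
  have e3 : ∫⁻ ω', G false (N.fade m s ω') ∂μ = 1 := by simp [G]
  rw [e2, e3, mul_one, ← ENNReal.ofReal_mul haq0,
    ← ENNReal.ofReal_add (by positivity) (sub_nonneg.2 haq1), ← ENNReal.ofReal_one,
    ← ENNReal.ofReal_sub _ (by positivity)]
  congr 1
  field_simp
  ring

theorem IsAloha.lintegral_expNeg_rx (h : N.IsAloha μ dens p q) (hp : 0 ≤ p) (hp1 : p ≤ 1)
    (hq : 0 ≤ q) (hq1 : q ≤ 1) {σ : ℝ} (hσ0 : 0 < σ)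
    (hσ : ∀ m s, HasLaw (fun ω => ‖N.fade m s ω‖) (rayleighMeasure σ) μ) (m t s : ℕ)
    {c r : ℝ} (α : ℝ) (hc : 0 ≤ c) (hr : 0 ≤ r) :
    ∫⁻ ω, expNeg (ENNReal.ofReal (c / (2 * σ ^ 2))
        * ENNReal.ofReal (r ^ (-α) * N.amplitude m t s ω ^ 2)) ∂μ
      = 1 - ENNReal.ofReal (interferenceLoss (N.energyProb μ 0 t * q) c α r) := by
  have hy : 0 ≤ c * r ^ (-α) := by positivity
  have e : ∀ ω, ENNReal.ofReal (c / (2 * σ ^ 2)) *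
      ENNReal.ofReal (r ^ (-α) * N.amplitude m t s ω ^ 2)
      = ENNReal.ofReal (c * r ^ (-α) / (2 * σ ^ 2) * N.amplitude m t s ω ^ 2) := by
    intro ω
    rw [← ENNReal.ofReal_mul (by positivity)]
    congr 1; ring
  simp_rw [e]
  exact h.lintegral_expNeg_amplitude hp hp1 hq hq1 hσ0 hσ m t s hy

theorem measurable_one_sub_interferenceLoss (a c α : ℝ) :
    Measurable fun r => 1 - ENNReal.ofReal (interferenceLoss a c α r) := by
  unfold interferenceLoss; fun_prop

/-- Interferers are integrated out one at a time: fading and activity of `s` are independent of the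
locations, the direction and the other interferers. -/
theorem IsAloha.lintegral_prod_expNeg (h : N.IsAloha μ dens p q) (hp : 0 ≤ p) (hp1 : p ≤ 1)
    (hq : 0 ≤ q) (hq1 : q ≤ 1) {σ : ℝ} (hσ0 : 0 < σ)
    (hσ : ∀ m s, HasLaw (fun ω => ‖N.fade m s ω‖) (rayleighMeasure σ) μ) (d α : ℝ) {c : ℝ}
    (hc : 0 ≤ c) (m t : ℕ) (F : Finset ℕ) {Φ : Ω → ℝ≥0∞}
    (hΦ : Measurable[N.sigma {.loc, .dir m}] Φ) :
    ∫⁻ ω, Φ ω * ∏ s ∈ F, expNeg (ENNReal.ofReal (c / (2 * σ ^ 2)) * N.activePower d α m t s ω) ∂μ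
      = ∫⁻ ω, Φ ω * ∏ s ∈ F, (1 - ENNReal.ofReal (interferenceLoss (N.energyProb μ 0 t * q) c α
        (dist (N.loc s ω) (N.receiver d m ω)))) ∂μ := by
  classical
  induction F using Finset.induction_on generalizing Φ with
  | empty => simp
  | insert s F hs ih =>
    have hρ : Measurable[N.sigma {.loc, .dir m}]
        fun ω => dist (N.loc s ω) (N.receiver d m ω) :=
      N.measurable_dist_receiver_sigma d m s (by simp) (by simp)
    have hsub : ({.loc, .dir m} : Set Source) ⊆ interferenceSources m t F :=
      Set.subset_union_left
    -- The averaged factor depends only on locations and direction, so it is absorbed into the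
    -- weight `Φ`, over which the induction is generalized.
    have hΦ' : Measurable[N.sigma {.loc, .dir m}] fun ω => Φ ω *
        (1 - ENNReal.ofReal (interferenceLoss (N.energyProb μ 0 t * q) c α
          (dist (N.loc s ω) (N.receiver d m ω)))) :=
      Measurable.mul hΦ ((measurable_one_sub_interferenceLoss _ c α).comp hρ)
    have ih' := ih hΦ'
    simp_rw [Finset.prod_insert hs, ← mul_assoc]
    rw [← ih']
    set P : Ω → ℝ≥0∞ := fun ω =>
      ∏ s ∈ F, expNeg (ENNReal.ofReal (c / (2 * σ ^ 2)) * N.activePower d α m t s ω) with hP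
    have hPm : Measurable[N.sigma (interferenceSources m t F)] P :=
      Finset.measurable_fun_prod _ fun s hs => measurable_expNeg.comp
        (Measurable.const_mul (N.measurable_activePower_sigma d α (F := (F : Set ℕ)) hs subset_rfl) _)
    have hX : Measurable[N.sigma (interferenceSources m t F)]
        fun ω => (Φ ω * P ω, dist (N.loc s ω) (N.receiver d m ω)) :=
      Measurable.prodMk (Measurable.mul (hΦ.mono (N.sigma_mono hsub) le_rfl) hPm)
        (hρ.mono (N.sigma_mono hsub) le_rfl)
    have hY := N.measurable_amplitude_sigma m t s subset_rfl
    have hF : Measurable (Function.uncurry fun (x : ℝ≥0∞ × ℝ) (z : ℝ) =>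
        x.1 * expNeg (ENNReal.ofReal (c / (2 * σ ^ 2)) * ENNReal.ofReal (x.2 ^ (-α) * z ^ 2))) :=
      (measurable_fst.comp measurable_fst).mul (measurable_expNeg.comp
        (((measurable_rx α).comp ((measurable_snd.comp measurable_fst).prodMk
          measurable_snd)).const_mul _))
    have key := h.lintegral_comp (disjoint_interferenceSources_amplitude
      (F := F) (m := m) (t := t) (by exact_mod_cast hs)) hX hY hF
    have hAm : Measurable (N.amplitude m t s) := hY.mono (h.sigma_le _) le_rfl
    calc _ = ∫⁻ ω, Φ ω * P ω * expNeg (ENNReal.ofReal (c / (2 * σ ^ 2)) *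
          ENNReal.ofReal (dist (N.loc s ω) (N.receiver d m ω) ^ (-α)
            * N.amplitude m t s ω ^ 2)) ∂μ := by
          refine lintegral_congr fun ω => ?_
          rw [mul_right_comm]
          rfl
      _ = _ := by
          rw [key]
          refine lintegral_congr fun ω => ?_
          have hm : Measurable fun ω' => expNeg (ENNReal.ofReal (c / (2 * σ ^ 2)) *
              ENNReal.ofReal (dist (N.loc s ω) (N.receiver d m ω) ^ (-α)
                * N.amplitude m t s ω' ^ 2)) := measurable_expNeg.comp (by fun_prop)
          rw [lintegral_const_mul _ hm,
            h.lintegral_expNeg_rx hp hp1 hq hq1 hσ0 hσ m t s α hc dist_nonneg]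
          exact mul_right_comm _ _ _

end Network

end EnergyHarvesting

/-! ### Success probability and transmission capacity -/

namespace EnergyHarvesting

namespace Network

variable {Ω : Type*} [MeasurableSpace Ω] {N : Network Ω} {μ : Measure Ω} [IsProbabilityMeasure μ]
  {dens p q : ℝ}

/-- Rayleigh fading of the desired signal turns the success probability into a Laplace transform
of the interference. -/
theorem IsAloha.measure_sir (h : N.IsAloha μ dens p q) {σ : ℝ} (hσ0 : 0 < σ)
    (hσ : ∀ m s, HasLaw (fun ω => ‖N.fade m s ω‖) (rayleighMeasure σ) μ)
    {d α θ : ℝ} (hd : 0 < d) (hθ : 0 < θ) {W : Set Plane} (hW : MeasurableSet W) (m t : ℕ) :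
    μ {ω | N.loc m ω ∈ W ∧ ENNReal.ofReal θ < N.sir d α m t ω}
      = ∫⁻ ω in N.loc m ⁻¹' W,
        expNeg (ENNReal.ofReal (θ * d ^ α / (2 * σ ^ 2)) * N.interference d α m t ω) ∂μ := by
  have hb : 0 < d ^ (-α) := Real.rpow_pos_of_pos hd _
  have hl : Measurable (N.loc m) := h.poisson.measurable m
  have hX1 : Measurable[N.sigma (interferenceSources m t {s | s ≠ m})] (N.loc m) :=
    N.measurable_loc_sigma (.inl (by simp)) m
  have hX : Measurable[N.sigma (interferenceSources m t {s | s ≠ m})]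
      fun ω => (N.loc m ω, N.interference d α m t ω) :=
    hX1.prodMk (N.measurable_interference_sigma d α m t)
  have hY : Measurable[N.sigma {.fade m m}] (N.fade m m) :=
    N.measurable_fade_sigma (Set.mem_singleton _)
  let B : Set ((Plane × ℝ≥0∞) × ℂ) := {z | z.1.1 ∈ W ∧
    ENNReal.ofReal θ < ENNReal.ofReal (d ^ (-α) * ‖z.2‖ ^ 2) / z.1.2}
  have hB : MeasurableSet B := by
    refine MeasurableSet.inter (hW.preimage (measurable_fst.comp measurable_fst)) ?_
    exact measurableSet_lt measurable_const
      (Measurable.div (by fun_prop) (measurable_snd.comp measurable_fst))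
  have hset : MeasurableSet {ω | N.loc m ω ∈ W ∧ ENNReal.ofReal θ < N.sir d α m t ω} := by
    have := hB.preimage ((hX.mono (h.sigma_le _) le_rfl).prodMk (h.measurable_fade m m))
    exact this
  have hF : Measurable (Function.uncurry fun (x : Plane × ℝ≥0∞) (y : ℂ) =>
      B.indicator (1 : (Plane × ℝ≥0∞) × ℂ → ℝ≥0∞) (x, y)) := measurable_one.indicator hB
  have key := h.lintegral_comp (disjoint_interferenceSources_fade m t) hX hY hF
  have e0 : ∀ ω, Set.indicator {ω | N.loc m ω ∈ W ∧ ENNReal.ofReal θ < N.sir d α m t ω} 1 ω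
      = B.indicator (1 : (Plane × ℝ≥0∞) × ℂ → ℝ≥0∞)
        ((N.loc m ω, N.interference d α m t ω), N.fade m m ω) := fun ω => rfl
  rw [← lintegral_indicator_one hset, lintegral_congr e0, key, ← lintegral_indicator (hl hW)]
  refine lintegral_congr fun ω => ?_
  by_cases hω : N.loc m ω ∈ W
  · rw [Set.indicator_of_mem (show ω ∈ N.loc m ⁻¹' W from hω)]
    generalize N.interference d α m t ω = i
    have hS : MeasurableSet {x : ℝ | ENNReal.ofReal θ < ENNReal.ofReal (d ^ (-α) * x ^ 2) / i} :=
      measurableSet_lt measurable_const (Measurable.div (by fun_prop) measurable_const)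
    have e1 : ∀ ω', B.indicator (1 : (Plane × ℝ≥0∞) × ℂ → ℝ≥0∞) ((N.loc m ω, i), N.fade m m ω')
        = Set.indicator {x : ℝ | ENNReal.ofReal θ < ENNReal.ofReal (d ^ (-α) * x ^ 2) / i} 1
          ‖N.fade m m ω'‖ := by
      intro ω'
      simp only [Set.indicator, B, Set.mem_ofPred_eq, hω, true_and, Pi.one_apply]
    simp_rw [e1]
    rw [h.lintegral_fade hσ m m (measurable_one.indicator hS), lintegral_indicator_one hS,
      rayleighMeasure_lt_div hσ0 hb hθ]
    congr 3
    rw [Real.rpow_neg hd.le]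
    have := Real.rpow_pos_of_pos hd α
    field_simp
  · rw [Set.indicator_of_notMem (show ω ∉ N.loc m ⁻¹' W from hω)]
    simp [Set.indicator, B, hω]

/-- Both integrands are decreasing limits of finite products, for which the averaging is already
known; the infimum leaves the integral by monotone convergence. -/
theorem IsAloha.setLIntegral_expNeg_interference (h : N.IsAloha μ dens p q)
    (hp : 0 ≤ p) (hp1 : p ≤ 1) (hq : 0 ≤ q) (hq1 : q ≤ 1) {σ : ℝ} (hσ0 : 0 < σ)
    (hσ : ∀ m s, HasLaw (fun ω => ‖N.fade m s ω‖) (rayleighMeasure σ) μ) (d α : ℝ) {c : ℝ}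
    (hc : 0 ≤ c) {W : Set Plane} (hW : MeasurableSet W) (m t : ℕ) :
    ∫⁻ ω in N.loc m ⁻¹' W,
        expNeg (ENNReal.ofReal (c / (2 * σ ^ 2)) * N.interference d α m t ω) ∂μ
      = ∫⁻ ω in N.loc m ⁻¹' W, prodExcept m (fun s => 1 - ENNReal.ofReal
        (interferenceLoss (N.energyProb μ 0 t * q) c α
          (dist (N.loc s ω) (N.receiver d m ω)))) ∂μ := by
  have hl : Measurable (N.loc m) := h.poisson.measurable m
  have e1 : ∀ ω, expNeg (ENNReal.ofReal (c / (2 * σ ^ 2)) * N.interference d α m t ω)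
      = prodExcept m fun s => if s = m then 1 else
        expNeg (ENNReal.ofReal (c / (2 * σ ^ 2)) * N.activePower d α m t s ω) := by
    intro ω
    rw [interference_eq_tsum, ← ENNReal.tsum_mul_left, expNeg_tsum]
    refine iInf_congr fun n => ?_
    have e : ∀ s, expNeg (ENNReal.ofReal (c / (2 * σ ^ 2)) *
        if s = m then 0 else N.activePower d α m t s ω) = if s = m then 1 else
        expNeg (ENNReal.ofReal (c / (2 * σ ^ 2)) * N.activePower d α m t s ω) := by
      intro s; split_ifs <;> simp
    simp_rw [e]
    exact (Finset.prod_erase (Finset.range n) (f := fun s => if s = m then 1 else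
      expNeg (ENNReal.ofReal (c / (2 * σ ^ 2)) * N.activePower d α m t s ω)) (if_pos rfl)).symm
  have hm1 : ∀ s, Measurable fun ω => if s = m then 1 else
      expNeg (ENNReal.ofReal (c / (2 * σ ^ 2)) * N.activePower d α m t s ω) := by
    intro s
    split_ifs
    · exact measurable_const
    · have : Measurable (N.activePower d α m t s) := (N.measurable_activePower_sigma d α
        (F := {s}) (Set.mem_singleton s) subset_rfl).mono (h.sigma_le _) le_rfl
      exact measurable_expNeg.comp (this.const_mul _)
  have hm2 : ∀ s, Measurable fun ω => 1 - ENNReal.ofReal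
        (interferenceLoss (N.energyProb μ 0 t * q) c α
          (dist (N.loc s ω) (N.receiver d m ω))) := by
    intro s
    have : Measurable fun ω => dist (N.loc s ω) (N.receiver d m ω) :=
      (N.measurable_dist_receiver_sigma d m s (S := {.loc, .dir m}) (by simp) (by simp)).mono
        (h.sigma_le _) le_rfl
    exact (measurable_one_sub_interferenceLoss _ c α).comp this
  simp_rw [e1]
  rw [lintegral_prodExcept m hm1, lintegral_prodExcept m hm2]
  · refine iInf_congr fun n => ?_
    have hW' : Measurable[N.sigma {.loc, .dir m}] ((N.loc m ⁻¹' W).indicator (1 : Ω → ℝ≥0∞)) :=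
      (measurable_one.indicator hW).comp (N.measurable_loc_sigma (by simp) m)
    have := h.lintegral_prod_expNeg hp hp1 hq hq1 hσ0 hσ d α hc m t ((Finset.range n).erase m)
      (Φ := (N.loc m ⁻¹' W).indicator 1) hW'
    rw [← lintegral_indicator (hl hW), ← lintegral_indicator (hl hW)]
    convert this using 1
    · refine lintegral_congr fun ω => ?_
      by_cases hω : ω ∈ N.loc m ⁻¹' W
      · rw [Set.indicator_of_mem hω, Set.indicator_of_mem hω, Pi.one_apply, one_mul]
        refine Finset.prod_congr rfl fun s hs => if_neg (Finset.ne_of_mem_erase hs)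
      · rw [Set.indicator_of_notMem hω, Set.indicator_of_notMem hω, zero_mul]
    · refine lintegral_congr fun ω => ?_
      by_cases hω : ω ∈ N.loc m ⁻¹' W
      · rw [Set.indicator_of_mem hω, Set.indicator_of_mem hω, Pi.one_apply, one_mul]
      · rw [Set.indicator_of_notMem hω, Set.indicator_of_notMem hω, zero_mul]
  · exact fun ω s => tsub_le_self
  · intro ω s
    split_ifs
    · exact le_rfl
    · exact expNeg_le_one _

/-- The conditional success probability of the transmitter `m`, located in `W`, given all locations
`x` and the displacement `u` of its receiver, when an interferer displaced by `z` from the receiver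
causes a loss `f z`. -/
noncomputable def condSuccess (f : Plane → ℝ≥0∞) (W : Set Plane) (m : ℕ) (x : ℕ → Plane)
    (u : Plane) : ℝ≥0∞ :=
  W.indicator 1 (x m) * prodExcept m fun s => 1 - f (x s - x m - u)

theorem measurable_condSuccess {f : Plane → ℝ≥0∞} (hf : Measurable f) {W : Set Plane}
    (hW : MeasurableSet W) (m : ℕ) :
    Measurable fun z : (ℕ → Plane) × Plane => condSuccess f W m z.1 z.2 := by
  have hx : ∀ s, Measurable fun z : (ℕ → Plane) × Plane => z.1 s := fun s =>
    (measurable_pi_apply s).comp measurable_fst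
  refine Measurable.mul ((measurable_one.indicator hW).comp (hx m)) ?_
  refine measurable_prodExcept m fun s => measurable_const.sub (hf.comp ?_)
  exact ((hx s).sub (hx m)).sub measurable_snd

omit [IsProbabilityMeasure μ] in
theorem setLIntegral_prodExcept_eq_condSuccess {T : ℕ → Ω → Plane} {f : Plane → ℝ≥0∞}
    {W : Set Plane} {m : ℕ} (hT : MeasurableSet (T m ⁻¹' W)) (u : Ω → Plane) :
    ∫⁻ ω in T m ⁻¹' W, prodExcept m (fun s => 1 - f (T s ω - T m ω - u ω)) ∂μ
      = ∫⁻ ω, condSuccess f W m (fun s => T s ω) (u ω) ∂μ := by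
  rw [← lintegral_indicator hT]
  refine lintegral_congr fun ω => ?_
  unfold condSuccess
  by_cases hω : T m ω ∈ W
  · rw [Set.indicator_of_mem (show ω ∈ T m ⁻¹' W from hω), Set.indicator_of_mem hω, Pi.one_apply,
      one_mul]
  · rw [Set.indicator_of_notMem (show ω ∉ T m ⁻¹' W from hω), Set.indicator_of_notMem hω, zero_mul]

omit [MeasurableSpace Ω] in
theorem measurable_locs_sigma (N : Network Ω) : Measurable[N.sigma {.loc}] fun ω m => N.loc m ω := by
  rw [@measurable_pi_iff]
  exact fun m => N.measurable_loc_sigma (Set.mem_singleton _) m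

/-- The direction of `m` is independent of the locations and may be replaced by that of transmitter
`0`. The outer average is then common to all `m`, and the sum over `m` can be taken at a fixed
displacement. -/
theorem IsAloha.measure_sir_eq_lintegral_condSuccess (h : N.IsAloha μ dens p q)
    (hp : 0 ≤ p) (hp1 : p ≤ 1) (hq : 0 ≤ q) (hq1 : q ≤ 1)
    {d α θ : ℝ} (hd : 0 < d) (hθ : 0 < θ) {W : Set Plane} (hW : MeasurableSet W) (m t : ℕ)
    {f : Plane → ℝ≥0∞} (hf : Measurable f) (hfz : ∀ z, f z = ENNReal.ofReal
      (interferenceLoss (N.energyProb μ 0 t * q) (θ * d ^ α) α ‖z‖)) :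
    μ {ω | N.loc m ω ∈ W ∧ ENNReal.ofReal θ < N.sir d α m t ω}
      = ∫⁻ ω', ∫⁻ ω, condSuccess f W m (fun s => N.loc s ω) (d • N.dir 0 ω') ∂μ ∂μ := by
  obtain ⟨σ, hσ0, hσ⟩ := h.rayleigh
  have hc : 0 ≤ θ * d ^ α := by positivity
  have hloc : Measurable[N.sigma {.loc}] fun ω m => N.loc m ω := N.measurable_locs_sigma
  have hloc' : Measurable fun ω m => N.loc m ω :=
    measurable_pi_lambda _ fun m => h.poisson.measurable m
  obtain ⟨F, hF⟩ : ∃ F : (ℕ → Plane) → Plane → ℝ≥0∞, ∀ x u, F x u = condSuccess f W m x (d • u) :=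
    ⟨_, fun _ _ => rfl⟩
  have hFm : Measurable (Function.uncurry F) := by
    have : Function.uncurry F = fun z => condSuccess f W m z.1 (d • z.2) :=
      funext fun z => hF z.1 z.2
    rw [this]
    exact (measurable_condSuccess hf hW m).comp
      (measurable_fst.prodMk (measurable_snd.const_smul d))
  have e1 : ∀ ω s, dist (N.loc s ω) (N.receiver d m ω)
      = ‖N.loc s ω - N.loc m ω - d • N.dir m ω‖ := fun ω s => by
    rw [dist_eq_norm, receiver, sub_sub]
  have e2 : ∀ x, ∫⁻ ω', F x (N.dir m ω') ∂μ = ∫⁻ ω', F x (N.dir 0 ω') ∂μ := fun x =>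
    ((h.ident_dir m).comp (hFm.comp measurable_prodMk_left)).lintegral_eq
  rw [h.measure_sir hσ0 hσ hd hθ hW,
    h.setLIntegral_expNeg_interference hp hp1 hq hq1 hσ0 hσ d α hc hW]
  simp_rw [e1, ← hfz]
  rw [setLIntegral_prodExcept_eq_condSuccess (h.poisson.measurable m hW)]
  simp_rw [← hF]
  have hdisj : Disjoint ({.loc} : Set Source) {.dir m} := by simp
  have hdir : Measurable[N.sigma {.dir m}] (N.dir m) :=
    N.measurable_dir_sigma (Set.mem_singleton _)
  refine (h.lintegral_comp hdisj hloc hdir hFm).trans ?_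
  simp_rw [e2]
  refine lintegral_lintegral_swap ?_
  exact (hFm.comp ((hloc'.comp measurable_fst).prodMk
    ((h.measurable_dir 0).comp measurable_snd))).aemeasurable

/-- For a fixed displacement Mecke's formula gives a value independent of it, so averaging over the
direction changes nothing. -/
theorem IsAloha.tsum_measure_sir (h : N.IsAloha μ dens p q) (hdens : 0 ≤ dens)
    (hp : 0 ≤ p) (hp1 : p ≤ 1) (hq : 0 ≤ q) (hq1 : q ≤ 1)
    {d α θ : ℝ} (hd : 0 < d) (hα : 2 < α) (hθ : 0 < θ)
    {W : Set Plane} (hW : MeasurableSet W) (hW1 : volume W ≠ ∞) (t : ℕ) :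
    ∑' m, μ {ω | N.loc m ω ∈ W ∧ ENNReal.ofReal θ < N.sir d α m t ω}
      = ENNReal.ofReal dens * volume W * ENNReal.ofReal
        (Real.exp (-(dens * (N.energyProb μ 0 t * q) / lambdaMax d α θ))) := by
  have hdα : 0 < d ^ α := Real.rpow_pos_of_pos hd α
  have hc : 0 < θ * d ^ α := mul_pos hθ hdα
  have haq0 : 0 ≤ N.energyProb μ 0 t * q := mul_nonneg measureReal_nonneg hq
  have haq1 : N.energyProb μ 0 t * q ≤ 1 := mul_le_one₀ measureReal_le_one hq hq1
  obtain ⟨f, hfz⟩ : ∃ f : Plane → ℝ≥0∞, ∀ z, f z = ENNReal.ofReal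
      (interferenceLoss (N.energyProb μ 0 t * q) (θ * d ^ α) α ‖z‖) := ⟨_, fun _ => rfl⟩
  have hf : f = fun z => ENNReal.ofReal
      (interferenceLoss (N.energyProb μ 0 t * q) (θ * d ^ α) α ‖z‖) := funext hfz
  have hf1 : ∀ z, f z ≤ 1 := by
    intro z
    have hy : 0 ≤ θ * d ^ α * ‖z‖ ^ (-α) := by positivity
    rw [hfz, ENNReal.ofReal_le_one]
    refine mul_le_one₀ haq1 (by positivity) ?_
    rw [div_le_one (by linarith)]
    linarith
  have hfl : LowerSemicontinuous f := by
    rw [hf]; exact lowerSemicontinuous_interferenceLoss hc (by linarith)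
  have hloc : Measurable fun ω m => N.loc m ω :=
    measurable_pi_lambda _ fun m => h.poisson.measurable m
  simp_rw [fun m => h.measure_sir_eq_lintegral_condSuccess hp hp1 hq hq1 hd hθ hW m t
    hfl.measurable hfz]
  rw [← lintegral_tsum]
  · have hin : ∀ u : Plane, ∑' m, ∫⁻ ω, condSuccess f W m (fun s => N.loc s ω) u ∂μ
        = ENNReal.ofReal dens * volume W * expNeg (ENNReal.ofReal dens * ∫⁻ y, f y) := by
      intro u
      rw [← h.poisson.tsum_lintegral_translation hdens hW hW1 hfl hf1 u]
      exact tsum_congr fun m =>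
        (setLIntegral_prodExcept_eq_condSuccess (h.poisson.measurable m hW) fun _ => u).symm
    simp_rw [hin]
    rw [lintegral_const, measure_univ, mul_one, hf, lintegral_interferenceLoss haq0 hc hα,
      ← ENNReal.ofReal_mul hdens, expNeg_ofReal]
    · congr 3
      have hk := kappa_pos hα
      have e4 : (θ * d ^ α) ^ (2 / α) = d ^ 2 * θ ^ (2 / α) := by
        rw [Real.mul_rpow hθ.le hdα.le, ← Real.rpow_mul hd.le,
          mul_div_cancel₀ _ (by linarith), mul_comm]
        norm_num
      rw [e4]
      unfold lambdaMax
      field_simp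
    · have hk := kappa_pos hα
      positivity
  · intro m
    refine Measurable.aemeasurable ?_
    exact Measurable.lintegral_prod_right' (f := fun z : Ω × Ω =>
      condSuccess f W m (fun s => N.loc s z.2) (d • N.dir 0 z.1))
      ((measurable_condSuccess hfl.measurable hW m).comp ((hloc.comp measurable_snd).prodMk
        (((h.measurable_dir 0).comp measurable_fst).const_smul d)))

theorem IsAloha.successProb_eq (h : N.IsAloha μ dens p q) (hdens : 0 < dens)
    (hp : 0 ≤ p) (hp1 : p ≤ 1) (hq : 0 ≤ q) (hq1 : q ≤ 1)
    {d α θ : ℝ} (hd : 0 < d) (hα : 2 < α) (hθ : 0 < θ)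
    {W : Set Plane} (hW : MeasurableSet W) (hW0 : volume W ≠ 0) (hW1 : volume W ≠ ∞) (t : ℕ) :
    N.successProb μ dens d α θ W t
      = Real.exp (-(dens * (N.energyProb μ 0 t * q) / lambdaMax d α θ)) := by
  have hv : 0 < volume.real W := ENNReal.toReal_pos hW0 hW1
  rw [successProb, h.tsum_measure_sir hdens.le hp hp1 hq hq1 hd hα hθ hW hW1, ENNReal.toReal_mul,
    ENNReal.toReal_mul, ENNReal.toReal_ofReal hdens.le, ENNReal.toReal_ofReal (Real.exp_nonneg _),
    ← measureReal_def]
  field_simp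

theorem IsAloha.tendsto_capacityAt (h : N.IsAloha μ dens p q) (hdens : 0 < dens)
    (hp : 0 ≤ p) (hp1 : p ≤ 1) (hq : 0 ≤ q) (hq1 : q ≤ 1)
    {d α θ : ℝ} (hd : 0 < d) (hα : 2 < α) (hθ : 0 < θ)
    {W : Set Plane} (hW : MeasurableSet W) (hW0 : volume W ≠ 0) (hW1 : volume W ≠ ∞) :
    Tendsto (fun t => N.capacityAt μ dens d α θ q W t) atTop
      (𝓝 (dens * min p q * Real.exp (-(dens * min p q / lambdaMax d α θ))
        * Real.logb 2 (1 + θ))) := by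
  have hlim : Tendsto (fun t => N.energyProb μ 0 t * q) atTop (𝓝 (min p q)) := by
    -- For `q = 0` the probability of having energy need not tend to `min (p / q) 1`, but its
    -- product with `q` vanishes.
    rcases hq.eq_or_lt with rfl | hq0
    · simp [min_eq_right hp]
    · have := (h.tendsto_energyProb hp hp1 hq0 hq1 0).mul_const q
      rwa [min_mul_of_nonneg _ _ hq, div_mul_cancel₀ _ hq0.ne', one_mul] at this
  have hcap : ∀ t, N.capacityAt μ dens d α θ q W t
      = dens * (N.energyProb μ 0 t * q)
        * Real.exp (-(dens * (N.energyProb μ 0 t * q) / lambdaMax d α θ))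
        * Real.logb 2 (1 + θ) := by
    intro t
    rw [capacityAt, h.successProb_eq hdens hp hp1 hq hq1 hd hα hθ hW hW0 hW1]
    ring
  simp_rw [hcap]
  have h1 := hlim.const_mul dens
  exact (h1.mul ((Real.continuous_exp.tendsto _).comp (h1.div_const _).neg)).mul_const _

end Network

/-! ### Maximizing the capacity -/

theorem lambdaMax_pos {d α θ : ℝ} (hd : 0 < d) (hα : 2 < α) (hθ : 0 < θ) :
    0 < lambdaMax d α θ := by
  have := kappa_pos hα
  unfold lambdaMax
  positivity

/-- This is the strict inequality `1 + u < exp u` at `u = x / l - 1`. -/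
theorem mul_exp_neg_div_lt {l x : ℝ} (hl : 0 < l) (hx : x ≠ l) :
    x * Real.exp (-(x / l)) < l * Real.exp (-(l / l)) := by
  have h1 : x / l - 1 ≠ 0 := by
    intro h
    exact hx (by field_simp at h; linarith)
  have h2 := Real.add_one_lt_exp h1
  have h3 : x / l < Real.exp (x / l - 1) := by linarith
  rw [div_self hl.ne']
  have h4 : x < l * Real.exp (x / l - 1) := by
    rw [div_lt_iff₀ hl] at h3; linarith
  calc x * Real.exp (-(x / l)) < l * Real.exp (x / l - 1) * Real.exp (-(x / l)) :=
        mul_lt_mul_of_pos_right h4 (Real.exp_pos _)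
    _ = l * Real.exp (-1) := by
        rw [mul_assoc, ← Real.exp_add]; congr 2; ring

/-- From `1 - u ≤ exp (-u)` at `u = (y - x) / l`, where `y ≤ l` gives `1 - u ≥ x / y`. -/
theorem mul_exp_neg_div_le_of_le {l x y : ℝ} (hx : 0 ≤ x) (hxy : x ≤ y)
    (hy : y ≤ l) : x * Real.exp (-(x / l)) ≤ y * Real.exp (-(y / l)) := by
  rcases hxy.eq_or_lt with rfl | hlt
  · exact le_rfl
  have hy0 : 0 < y := hx.trans_lt hlt
  have h1 : 1 - (y - x) / l ≤ Real.exp (-((y - x) / l)) := Real.one_sub_le_exp_neg _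
  have h2 : (y - x) / l ≤ (y - x) / y := div_le_div_of_nonneg_left (by linarith) hy0 hy
  have h3 : x / y ≤ Real.exp (-((y - x) / l)) := by
    have : x / y = 1 - (y - x) / y := by field_simp; ring
    linarith
  have h4 : x ≤ y * Real.exp (-((y - x) / l)) := by
    rw [div_le_iff₀ hy0] at h3; linarith
  calc x * Real.exp (-(x / l)) ≤ y * Real.exp (-((y - x) / l)) * Real.exp (-(x / l)) :=
        mul_le_mul_of_nonneg_right h4 (Real.exp_nonneg _)
    _ = y * Real.exp (-(y / l)) := by
        rw [mul_assoc, ← Real.exp_add]; congr 2; ring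

end EnergyHarvesting

theorem theorem1 {Ω : Type*} [MeasurableSpace Ω] (μ : Measure Ω) [IsProbabilityMeasure μ]
    (dens d α θ p : ℝ) (hdens : 0 < dens) (hd : 0 < d) (hα : 2 < α) (hθ : 0 < θ)
    (hp : 0 < p) (hp1 : p ≤ 1)
    (W : Set Plane) (hW : MeasurableSet W) (hW0 : volume W ≠ 0) (hW1 : volume W ≠ ∞)
    (N : ℝ → Network Ω) (hN : ∀ q ∈ Set.Icc (0 : ℝ) 1, (N q).IsAloha μ dens p q) :
    ∃ C : ℝ → ℝ,
      (∀ q ∈ Set.Icc (0 : ℝ) 1,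
        Tendsto (fun t => (N q).capacityAt μ dens d α θ q W t) atTop (𝓝 (C q))) ∧
      (∀ q ∈ Set.Ioc (0 : ℝ) 1, ∃ r : ℝ, r = min (p / q) 1 ∧
        (∀ m, Tendsto (fun t => (N q).energyProb μ m t) atTop (𝓝 r)) ∧
        C q = dens * r * q * Real.exp (-(dens * r * q / lambdaMax d α θ))
          * Real.logb 2 (1 + θ)) ∧
      (lambdaMax d α θ / dens < p → optimalProbs C = {lambdaMax d α θ / dens}) ∧
      (p ≤ lambdaMax d α θ / dens → Set.Icc p 1 ⊆ optimalProbs C) := by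
  have hl := lambdaMax_pos hd hα hθ
  have hR : 0 < Real.logb 2 (1 + θ) := Real.logb_pos (by norm_num) (by linarith)
  set l := lambdaMax d α θ with hldef
  -- Since `r q = min p q` for `q > 0`, this form of the capacity also covers `q = 0`.
  refine ⟨fun q => dens * min p q * Real.exp (-(dens * min p q / l)) * Real.logb 2 (1 + θ),
    fun q hq => (hN q hq).tendsto_capacityAt hdens hp.le hp1 hq.1 hq.2 hd hα hθ hW hW0 hW1,
    fun q hq => ⟨_, rfl, fun m =>
      (hN q ⟨hq.1.le, hq.2⟩).tendsto_energyProb hp.le hp1 hq.1 hq.2 m, ?_⟩, fun hlt => ?_,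
    fun hle => ?_⟩
  · have e : dens * min (p / q) 1 * q = dens * min p q := by
      rw [mul_assoc, min_mul_of_nonneg _ _ hq.1.le, div_mul_cancel₀ _ hq.1.ne', one_mul]
    simp only [e]
  · have hmem : l / dens ∈ Set.Icc (0 : ℝ) 1 := ⟨by positivity, hlt.le.trans hp1⟩
    have hval : dens * min p (l / dens) = l := by
      rw [min_eq_right hlt.le]; field_simp
    -- As `p` exceeds `l / dens`, the peak is reached only if `q` itself is the smaller of the two
    -- and equals `l / dens`.
    have hne : ∀ q, q ≠ l / dens → dens * min p q ≠ l := by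
      intro q hq h
      have h1 : min p q = l / dens := by rw [← h]; field_simp
      rcases min_choice p q with h2 | h2
      · exact hlt.ne (by rw [← h1, h2])
      · exact hq (by rw [← h1, h2])
    ext q
    simp only [optimalProbs, Set.mem_ofPred_eq, Set.mem_singleton_iff]
    constructor
    · rintro ⟨_, hq⟩
      by_contra hne'
      have h1 := hq _ hmem
      rw [hval] at h1
      have h2 := mul_lt_mul_of_pos_right (mul_exp_neg_div_lt hl (hne q hne')) hR
      exact absurd h1 (not_le.2 h2)
    · rintro rfl
      refine ⟨hmem, fun q' _ => ?_⟩
      by_cases hq' : q' = l / dens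
      · rw [hq']
      · rw [hval]
        exact (mul_lt_mul_of_pos_right (mul_exp_neg_div_lt hl (hne q' hq')) hR).le
  · intro q hq
    refine ⟨⟨hp.le.trans hq.1, hq.2⟩, fun q' hq' => ?_⟩
    -- For `q ≥ p` the active density saturates at `dens * p ≤ l`, where the objective is still
    -- nondecreasing, and no other `q'` gives a larger density.
    simp only [min_eq_left hq.1]
    refine mul_le_mul_of_nonneg_right (mul_exp_neg_div_le_of_le ?_ ?_ ?_) hR.le
    · exact mul_nonneg hdens.le (le_min hp.le hq'.1)
    · exact mul_le_mul_of_nonneg_left (min_le_left _ _) hdens.le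
    · rw [le_div_iff₀ hdens] at hle; linarith
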